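/- Let $\lambda\in(0,\infty)$, $\beta\in(-1,0)$, and let $\alpha$ be a random variable with values in $(0,1)$ having a probability density of the form $\psi(x)(1-x)^\beta$, $x\in(0,1)$, where $\psi$ is a function on $(0,1)$ with $\lim_{x\uparrow1}\psi(x)=\psi_1\in(0,\infty)$. Let $(X_k)_{k\ge0}$ be the randomized INAR(1) process with Poisson innovations and mixing variable $\alpha$, i.e. $$X_k=\sum_{i=1}^{X_{k-1}}\xi_{k,i}+\varepsilon_k,\qquad k\ge1,$$ where, conditionally on $\alpha$, the non-negative integer-valued random variables $X_0$, $\xi_{k,i}$, $\varepsilon_k$ ($k,i\ge1$) are independent, $\xi_{k,i}$ is Bernoulli with mean $\alpha$, $\varepsilon_k$ is Poisson with parameter $\lambda$, and $X_0$ is Poisson with parameter $\lambda/(1-\alpha)$. Let $(\alpha^{(j)},(X^{(j)}_k)_{k\ge0})$, $j\ge1$, be independent copies of $(\alpha,(X_k)_{k\ge0})$, each $X^{(j)}$ being constructed in this way from $\alpha^{(j)}$, and for $N,n\in\mathbb N$ set $$\widetilde S^{(N,n)}_t:=\sum_{j=1}^N\sum_{k=1}^{\lfloor nt\rfloor}\bigl(X^{(j)}_k-\mathbb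 E(X^{(j)}_k\mid\alpha^{(j)})\bigr),\qquad t\in[0,\infty),$$ where the conditional expectation is taken in the generalized sense for non-negative (not necessarily integrable) random variables. Then, for every $n\in\mathbb N$, the finite-dimensional distributions of $\bigl(n^{-1}N^{-\frac1{2(1+\beta)}}\widetilde S^{(N,n)}_t\bigr)_{t\ge0}$ converge weakly, as $N\to\infty$, to those of some process $(Y^{(n)}_t)_{t\ge0}$; and, as $n\to\infty$, the finite-dimensional distributions of $Y^{(n)}$ converge weakly to those of $(V_{2(1+\beta)}\,t)_{t\ge0}$, where $V_{2(1+\beta)}$ is a symmetric $2(1+\beta)$-stable random variable (not depending on $t$) with characteristic function $$\mathbb E\bigl(e^{i\theta V_{2(1+\beta)}}\bigr)=e^{-K_\beta|\theta|^{2(1+\beta)}},\quad\theta\in\mathbb R,\qquad K_\beta:=\psi_1\Bigl(\frac\lambda2\Bigr)^{1+\beta}\frac{\Gamma(-\beta)}{1+\beta}.$$ -/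

import Mathlib

open MeasureTheory ProbabilityTheory Filter Topology
open scoped NNReal ENNReal

/-- Indices of the primitive `ℕ`-valued random variables driving one randomized INAR(1) process:
the initial value `X₀`, the innovations `ε_{k+1}` (`innov k`) and the Bernoulli offspring
variables `ξ_{k+1,i+1}` (`offspring k i`), with `k i : ℕ` counted from `0`. -/
inductive InarIndex : Type
  | init : InarIndex
  | innov (k : ℕ) : InarIndex
  | offspring (k i : ℕ) : InarIndex

/-- The path of an INAR(1) process built from its primitive variables:
`X_{k+1} = ∑_{i=1}^{X_k} ξ_{k+1,i} + ε_{k+1}`. -/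
def inarProcess {Ω : Type*} (Z : InarIndex → Ω → ℕ) : ℕ → Ω → ℕ
  | 0, ω => Z InarIndex.init ω
  | k + 1, ω =>
      (∑ i ∈ Finset.range (inarProcess Z k ω), Z (InarIndex.offspring k i) ω)
        + Z (InarIndex.innov k) ω

/-- The σ-algebra generated by a real random variable. -/
abbrev sigmaOf {Ω : Type*} (A : Ω → ℝ) : MeasurableSpace Ω :=
  MeasurableSpace.comap A inferInstance

/-- `A` is the random thinning parameter and `Z` the primitive variables of a randomized INAR(1)
process with Poisson(`lam`) innovations: given `A`, the variables `Z` are conditionally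
independent, the offspring variables are Bernoulli(`A`), the innovations are Poisson(`lam`) and the
initial value is Poisson(`lam / (1 - A)`). -/
structure IsRandomizedInar {Ω : Type*} [MeasurableSpace Ω] (P : Measure Ω) (lam : ℝ)
    (A : Ω → ℝ) (Z : InarIndex → Ω → ℕ) : Prop where
  measurable_param : Measurable A
  param_mem : ∀ᵐ ω ∂P, A ω ∈ Set.Ioo (0 : ℝ) 1
  measurable_prim : ∀ i, Measurable (Z i)
  condIndep : ∀ (s : Finset InarIndex) (B : InarIndex → Set ℕ),
    P⟦⋂ i ∈ s, Z i ⁻¹' B i | sigmaOf A⟧ =ᵐ[P] ∏ i ∈ s, P⟦Z i ⁻¹' B i | sigmaOf A⟧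
  offspring_one : ∀ k i : ℕ,
    P⟦Z (InarIndex.offspring k i) ⁻¹' {1} | sigmaOf A⟧ =ᵐ[P] fun ω => A ω
  offspring_zero : ∀ k i : ℕ,
    P⟦Z (InarIndex.offspring k i) ⁻¹' {0} | sigmaOf A⟧ =ᵐ[P] fun ω => 1 - A ω
  innov_poisson : ∀ k l : ℕ,
    P⟦Z (InarIndex.innov k) ⁻¹' {l} | sigmaOf A⟧
      =ᵐ[P] fun _ => lam ^ l / (l.factorial : ℝ) * Real.exp (-lam)
  init_poisson : ∀ l : ℕ,
    P⟦Z InarIndex.init ⁻¹' {l} | sigmaOf A⟧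
      =ᵐ[P] fun ω => lam ^ l / ((l.factorial : ℝ) * (1 - A ω) ^ l)
        * Real.exp (-((1 - A ω)⁻¹ * lam))

/-- The conditional expectation `E(Y | A)` of an `ℕ`-valued random variable `Y`, in the generalized
sense for non-negative variables that need not be integrable. -/
noncomputable def condMean {Ω : Type*} [MeasurableSpace Ω] (P : Measure Ω) (A : Ω → ℝ)
    (Y : Ω → ℕ) (ω : Ω) : ℝ :=
  (condLExp (sigmaOf A) P (fun ω' => (Y ω' : ℝ≥0∞)) ω).toReal

/-- The doubly aggregated process, centred by conditional expectations,
`∑_{j=1}^N ∑_{k=1}^{⌊nt⌋} (X^{(j)}_k - E(X^{(j)}_k | α^{(j)}))`, with copies indexed from `0`. -/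
noncomputable def aggregated {Ω : Type*} [MeasurableSpace Ω] (P : Measure Ω) (A : ℕ → Ω → ℝ)
    (X : ℕ → ℕ → Ω → ℕ) (N n : ℕ) (t : ℝ≥0) (ω : Ω) : ℝ :=
  ∑ j ∈ Finset.range N, ∑ k ∈ Finset.Icc 1 ⌊(n : ℝ≥0) * t⌋₊,
    ((X j k ω : ℝ) - condMean P (A j) (X j k) ω)

/-- Weak convergence of the finite dimensional distributions of the processes
`(Y n t)_{t ≥ 0}` to those of `(W t)_{t ≥ 0}` as `n → ∞`. -/
def FddTendsto {Ω Ω' : Type*} [MeasurableSpace Ω] [MeasurableSpace Ω']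
    (Y : ℕ → ℝ≥0 → Ω → ℝ) (P : Measure Ω) [IsProbabilityMeasure P]
    (W : ℝ≥0 → Ω' → ℝ) (P' : Measure Ω') [IsProbabilityMeasure P'] : Prop :=
  ∀ (m : ℕ) (t : Fin m → ℝ≥0),
    TendstoInDistribution (fun (n : ℕ) (ω : Ω) (i : Fin m) => Y n (t i) ω) atTop
      (fun (ω : Ω') (i : Fin m) => W (t i) ω) (fun _ => P) P'

/-- `ν` is a (non-degenerate) symmetric `a`-stable law: if `V₁, V₂` are independent with law `ν`,
then `-V₁` has law `ν`, and `b V₁ + c V₂` has the law of `(b ^ a + c ^ a) ^ (1 / a) V₁` for all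
`b, c > 0`. -/
structure IsSymmetricStable (a : ℝ) (ν : Measure ℝ) : Prop where
  index_mem : a ∈ Set.Ioc (0 : ℝ) 2
  isProbabilityMeasure : IsProbabilityMeasure ν
  ne_dirac : ν ≠ Measure.dirac 0
  symmetric : ν.map (fun x => -x) = ν
  stable : ∀ b c : ℝ, 0 < b → 0 < c →
    (ν.map (fun x => b * x)).conv (ν.map (fun x => c * x))
      = ν.map (fun x => (b ^ a + c ^ a) ^ (1 / a) * x)

/-! Given `α = a`, the chain is stationary with Poisson marginals of mean and variance `m =
λ/(1-a)`, while `E(X_{k+1} - X_k)² = 2λ` whatever `a` is (`IsInar.moments`,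
`IsInar.integral_succ_sub_sq`). Large fluctuations come from `a` near 1, and there a path over a
fixed window is almost constant: `∑ c_k (X_k - m) = C (X_0 - m) + R` with `C = ∑ c_k` and `R`
bounded in `L²` uniformly in `a`. Replacing the centred Poisson variable `X_0 - m` by a Gaussian
one, the conditional characteristic function at scale `u` is close to `exp(-κ u²/(1-a))`, where `κ =
λC²/2` (`IsInar.norm_integral_exp_sub_gaussian_le`).

Averaging over `a` and substituting `1 - a = u² y`, one minus the Gaussian mixture is asymptotic to
`u^{2(1+β)} ψ₁ ∫ y^β (1 - e^{-κ/y}) dy`, and this integral equals `κ^{1+β} Γ(-β)/(1+β)`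
(`tendsto_rpow_mul_integral_mixingMeasure`). With `u = N^{-1/(2(1+β))}` the `N`-th power tends to
`exp(-K |C|^{2(1+β)})`. The approximation error per copy is `O(u^{1+p} + u^{3p})` times `E
(1-α)^{-p}`. Finiteness of the moment needs `p < 1+β`, and the error survives multiplication by `N`
when `1+p` and `3p` exceed `2(1+β)`; such a `p` exists because `-1 < β < 0`
(`exists_error_exponent`).

The limit depends on the weights only through `C`, which for a linear combination over times `t_i`
is `∑ θ_i ⌊n t_i⌋/n`. By Cramér–Wold the limit process is `Y^{(n)}_t = V ⌊nt⌋/n` with a single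
stable `V`, and `⌊nt⌋/n → t` gives the second limit. -/

/-! ### The stable constant as a Gamma integral -/

lemma lintegral_Ioo_exp_neg {c : ℝ} (hc : 0 ≤ c) :
    ∫⁻ s in Set.Ioo 0 c, ENNReal.ofReal (Real.exp (-s)) = ENNReal.ofReal (1 - Real.exp (-c)) := by
  rw [← ofReal_integral_eq_lintegral_ofReal]
  · rw [← integral_Ioc_eq_integral_Ioo, ← intervalIntegral.integral_of_le hc]
    congr 1
    have := intervalIntegral.integral_comp_neg (a := 0) (b := c) (fun s => Real.exp s)
    rw [this, integral_exp]
    simp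
  · have : IntegrableOn (fun s => Real.exp (-s)) (Set.Icc 0 c) :=
      (by fun_prop : Continuous fun s => Real.exp (-s)).continuousOn.integrableOn_Icc
    exact this.mono_set Set.Ioo_subset_Icc_self
  · exact ae_of_all _ fun s => (Real.exp_pos _).le

lemma integrableOn_Ioo_rpow {r c : ℝ} (hr : -1 < r) :
    IntegrableOn (fun y : ℝ => y ^ r) (Set.Ioo 0 c) := by
  rcases le_or_gt c 0 with hc | hc
  · simp [Set.Ioo_eq_empty_of_le hc]
  · have h := intervalIntegral.intervalIntegrable_rpow' (a := 0) (b := c) hr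
    rw [intervalIntegrable_iff_integrableOn_Ioo_of_le hc.le] at h
    exact h

lemma lintegral_Ioo_rpow {r c : ℝ} (hr : -1 < r) (hc : 0 ≤ c) :
    ∫⁻ y in Set.Ioo 0 c, ENNReal.ofReal (y ^ r) = ENNReal.ofReal (c ^ (1 + r) / (1 + r)) := by
  rw [← ofReal_integral_eq_lintegral_ofReal (integrableOn_Ioo_rpow hr)]
  · rw [← integral_Ioc_eq_integral_Ioo, ← intervalIntegral.integral_of_le hc,
      integral_rpow (Or.inl hr), Real.zero_rpow (by linarith)]
    simp [add_comm]
  · filter_upwards [ae_restrict_mem measurableSet_Ioo] with y hy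
    exact Real.rpow_nonneg hy.1.le _

/-- Write `1 - e^{-κ/y}` as the integral of `e^{-s}` over `0 < s < κ/y` and apply Tonelli on the
region `y s < κ`. Integrating `y^β` over `(0, κ/s)` first leaves `κ^{1+β}/(1+β)` times the Gamma
integral of `e^{-s} s^{-β-1}`. -/
lemma lintegral_Ioi_rpow_mul_one_sub_exp {β κ : ℝ} (hβ : β ∈ Set.Ioo (-1 : ℝ) 0) (hκ : 0 ≤ κ) :
    ∫⁻ y in Set.Ioi 0, ENNReal.ofReal (y ^ β * (1 - Real.exp (-(κ / y))))
      = ENNReal.ofReal (κ ^ (1 + β) * (Real.Gamma (-β) / (1 + β))) := by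
  set S : Set (ℝ × ℝ) := {p | p.1 * p.2 < κ}
  have hS : MeasurableSet S := (isOpen_lt (by fun_prop) (by fun_prop)).measurableSet
  have hb : 0 < 1 + β := by linarith [hβ.1]
  have key := lintegral_lintegral_swap (μ := volume.restrict (Set.Ioi (0 : ℝ)))
    (ν := volume.restrict (Set.Ioi (0 : ℝ)))
    (f := fun y s => S.indicator
      (fun p => ENNReal.ofReal (p.1 ^ β) * ENNReal.ofReal (Real.exp (-p.2))) (y, s))
    ((Measurable.indicator (by fun_prop) hS).aemeasurable)
  have hset : ∀ y : ℝ, 0 < y → {s | y * s < κ} ∩ Set.Ioi 0 = Set.Ioo 0 (κ / y) := by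
    intro y hy
    ext s
    simp only [Set.mem_inter_iff, Set.mem_ofPred_eq, Set.mem_Ioi, Set.mem_Ioo, lt_div_iff₀ hy,
      mul_comm y, and_comm]
  have hset' : ∀ s : ℝ, 0 < s → {y | y * s < κ} ∩ Set.Ioi 0 = Set.Ioo 0 (κ / s) := by
    intro s hs
    ext y
    simp only [Set.mem_inter_iff, Set.mem_ofPred_eq, Set.mem_Ioi, Set.mem_Ioo, lt_div_iff₀ hs,
      and_comm]
  have h1 : ∀ y : ℝ, 0 < y → ∫⁻ s in Set.Ioi 0, S.indicator
      (fun p => ENNReal.ofReal (p.1 ^ β) * ENNReal.ofReal (Real.exp (-p.2))) (y, s)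
      = ENNReal.ofReal (y ^ β * (1 - Real.exp (-(κ / y)))) := by
    intro y hy
    have : ∀ s, S.indicator
        (fun p => ENNReal.ofReal (p.1 ^ β) * ENNReal.ofReal (Real.exp (-p.2))) (y, s)
        = {s | y * s < κ}.indicator
          (fun s => ENNReal.ofReal (y ^ β) * ENNReal.ofReal (Real.exp (-s))) s := fun s => rfl
    simp_rw [this]
    rw [lintegral_indicator (isOpen_lt (by fun_prop) (by fun_prop)).measurableSet,
      Measure.restrict_restrict (isOpen_lt (by fun_prop) (by fun_prop)).measurableSet,
      hset y hy, lintegral_const_mul _ (by fun_prop), lintegral_Ioo_exp_neg (by positivity),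
      ENNReal.ofReal_mul (Real.rpow_nonneg hy.le _)]
  have h2 : ∀ s : ℝ, 0 < s → ∫⁻ y in Set.Ioi 0, S.indicator
      (fun p => ENNReal.ofReal (p.1 ^ β) * ENNReal.ofReal (Real.exp (-p.2))) (y, s)
      = ENNReal.ofReal (κ ^ (1 + β) / (1 + β) * (Real.exp (-s) * s ^ (-β - 1))) := by
    intro s hs
    have : ∀ y, S.indicator
        (fun p => ENNReal.ofReal (p.1 ^ β) * ENNReal.ofReal (Real.exp (-p.2))) (y, s)
        = {y | y * s < κ}.indicator
          (fun y => ENNReal.ofReal (y ^ β) * ENNReal.ofReal (Real.exp (-s))) y := fun y => rfl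
    simp_rw [this]
    rw [lintegral_indicator (isOpen_lt (by fun_prop) (by fun_prop)).measurableSet,
      Measure.restrict_restrict (isOpen_lt (by fun_prop) (by fun_prop)).measurableSet,
      hset' s hs, lintegral_mul_const _ (by fun_prop), lintegral_Ioo_rpow hβ.1 (by positivity),
      ← ENNReal.ofReal_mul (by positivity), Real.div_rpow hκ hs.le]
    congr 1
    rw [show -β - 1 = -(1 + β) by ring, Real.rpow_neg hs.le]
    ring
  rw [setLIntegral_congr_fun measurableSet_Ioi (fun y hy => h1 y hy)] at key
  rw [key, setLIntegral_congr_fun measurableSet_Ioi (fun s hs => h2 s hs),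
    ← ofReal_integral_eq_lintegral_ofReal, integral_const_mul, Real.Gamma_eq_integral]
  · congr 1
    ring
  · linarith [hβ.2]
  · exact (Real.GammaIntegral_convergent (by linarith [hβ.2])).const_mul _
  · filter_upwards [ae_restrict_mem measurableSet_Ioi] with s hs
    have : (0 : ℝ) < s := hs
    simp only [Pi.zero_apply]
    positivity

lemma rpow_mul_one_sub_exp_nonneg {β κ y : ℝ} (hκ : 0 ≤ κ) (hy : 0 ≤ y) :
    0 ≤ y ^ β * (1 - Real.exp (-(κ / y))) := by
  have : Real.exp (-(κ / y)) ≤ 1 := Real.exp_le_one_iff.2 (by simp; positivity)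
  exact mul_nonneg (Real.rpow_nonneg hy _) (by linarith)

lemma integrableOn_Ioi_rpow_mul_one_sub_exp {β κ : ℝ} (hβ : β ∈ Set.Ioo (-1 : ℝ) 0)
    (hκ : 0 ≤ κ) :
    IntegrableOn (fun y => y ^ β * (1 - Real.exp (-(κ / y)))) (Set.Ioi 0) := by
  refine (lintegral_ofReal_ne_top_iff_integrable ?_ ?_).1 ?_
  · exact (by fun_prop : Measurable fun y : ℝ => y ^ β * (1 - Real.exp (-(κ / y)))).aestronglyMeasurable
  · filter_upwards [ae_restrict_mem measurableSet_Ioi] with y hy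
    exact rpow_mul_one_sub_exp_nonneg hκ (le_of_lt hy)
  · rw [lintegral_Ioi_rpow_mul_one_sub_exp hβ hκ]
    exact ENNReal.ofReal_ne_top

lemma integral_Ioi_rpow_mul_one_sub_exp {β κ : ℝ} (hβ : β ∈ Set.Ioo (-1 : ℝ) 0) (hκ : 0 ≤ κ) :
    ∫ y in Set.Ioi 0, y ^ β * (1 - Real.exp (-(κ / y)))
      = κ ^ (1 + β) * (Real.Gamma (-β) / (1 + β)) := by
  rw [integral_eq_lintegral_of_nonneg_ae, lintegral_Ioi_rpow_mul_one_sub_exp hβ hκ,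
    ENNReal.toReal_ofReal]
  · have := Real.Gamma_pos_of_pos (s := -β) (by linarith [hβ.2])
    have : 0 < 1 + β := by linarith [hβ.1]
    positivity
  · filter_upwards [ae_restrict_mem measurableSet_Ioi] with y hy
    exact rpow_mul_one_sub_exp_nonneg hκ (le_of_lt hy)
  · exact (by fun_prop : Measurable fun y : ℝ => y ^ β * (1 - Real.exp (-(κ / y)))).aestronglyMeasurable

/-! ### The mixing law near 1 and its Abelian asymptotics -/

/-- The mixing law, with density `ψ(x) (1 - x) ^ β` on `(0, 1)`. -/
noncomputable abbrev mixingMeasure (ψ : ℝ → ℝ) (β : ℝ) : Measure ℝ :=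
  (volume.restrict (Set.Ioo (0 : ℝ) 1)).withDensity
    (fun x => ENNReal.ofReal (ψ x * (1 - x) ^ β))

lemma exists_bound_of_tendsto_left {ψ : ℝ → ℝ} {ψ₁ : ℝ} (hψ_lim : Tendsto ψ (𝓝[<] 1) (𝓝 ψ₁)) :
    ∃ δ ∈ Set.Ioo (0 : ℝ) 1, ∀ x ∈ Set.Ioo (1 - δ) 1, |ψ x| ≤ |ψ₁| + 1 := by
  have h1 : ∀ᶠ x in 𝓝[<] (1 : ℝ), |ψ x| ≤ |ψ₁| + 1 :=
    (hψ_lim.abs.eventually_lt_const (by linarith : |ψ₁| < |ψ₁| + 1)).mono fun _ h => h.le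
  obtain ⟨l, hl, h⟩ := (mem_nhdsLT_iff_exists_Ioo_subset' (zero_lt_one (α := ℝ))).1 h1
  have hl1 : l < 1 := hl
  refine ⟨min (1 - l) (1 / 2), ⟨lt_min (by linarith) (by norm_num), ?_⟩, fun x hx => h ⟨?_, hx.2⟩⟩
  · exact (min_le_right _ _).trans_lt (by norm_num)
  · have := min_le_left (1 - l) (1 / 2 : ℝ)
    linarith [hx.1]

lemma aemeasurable_mixing_density {ψ : ℝ → ℝ} {β : ℝ}
    (hψ_meas : AEMeasurable ψ (volume.restrict (Set.Ioo (0 : ℝ) 1))) :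
    AEMeasurable (fun x => ENNReal.ofReal (ψ x * (1 - x) ^ β))
      (volume.restrict (Set.Ioo (0 : ℝ) 1)) :=
  (hψ_meas.mul (by fun_prop)).ennreal_ofReal

lemma restrict_mixingMeasure_Ioi {ψ : ℝ → ℝ} {β δ : ℝ} (hδ : δ ∈ Set.Ioo (0 : ℝ) 1) :
    (mixingMeasure ψ β).restrict (Set.Ioi (1 - δ))
      = (volume.restrict (Set.Ioo (1 - δ) 1)).withDensity
        (fun x => ENNReal.ofReal (ψ x * (1 - x) ^ β)) := by
  rw [mixingMeasure, restrict_withDensity measurableSet_Ioi,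
    Measure.restrict_restrict measurableSet_Ioi]
  congr 2
  ext x
  simp only [Set.mem_inter_iff, Set.mem_Ioi, Set.mem_Ioo]
  constructor
  · rintro ⟨h1, -, h2⟩
    exact ⟨h1, h2⟩
  · rintro ⟨h1, h2⟩
    exact ⟨h1, by linarith [hδ.2], h2⟩

lemma Ioo_one_sub_subset {δ : ℝ} (hδ : δ ∈ Set.Ioo (0 : ℝ) 1) :
    Set.Ioo (1 - δ) 1 ⊆ Set.Ioo (0 : ℝ) 1 :=
  Set.Ioo_subset_Ioo_left (by linarith [hδ.2])

lemma ae_mixingMeasure_mem {ψ : ℝ → ℝ} {β : ℝ} :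
    ∀ᵐ a ∂(mixingMeasure ψ β), a ∈ Set.Ioo (0 : ℝ) 1 :=
  (withDensity_absolutelyContinuous _ _).ae_le (ae_restrict_mem measurableSet_Ioo)

lemma setIntegral_mixingMeasure_Ioi {ψ : ℝ → ℝ} {β δ : ℝ} (hδ : δ ∈ Set.Ioo (0 : ℝ) 1)
    (hψ_meas : AEMeasurable ψ (volume.restrict (Set.Ioo (0 : ℝ) 1)))
    (hψ_nonneg : ∀ x ∈ Set.Ioo (0 : ℝ) 1, 0 ≤ ψ x) (f : ℝ → ℝ) :
    ∫ a in Set.Ioi (1 - δ), f a ∂(mixingMeasure ψ β)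
      = ∫ a in Set.Ioo (1 - δ) 1, ψ a * (1 - a) ^ β * f a := by
  rw [restrict_mixingMeasure_Ioi hδ, integral_withDensity_eq_integral_toReal_smul₀]
  · refine setIntegral_congr_fun measurableSet_Ioo fun a ha => ?_
    have h0 := hψ_nonneg a (Ioo_one_sub_subset hδ ha)
    have : 0 ≤ (1 - a) ^ β := Real.rpow_nonneg (by linarith [ha.2]) _
    simp only [smul_eq_mul]
    rw [ENNReal.toReal_ofReal (by positivity)]
  · exact (aemeasurable_mixing_density hψ_meas).mono_measure
      (Measure.restrict_mono (Ioo_one_sub_subset hδ) le_rfl)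
  · exact ae_of_all _ fun _ => ENNReal.ofReal_lt_top

/-- Away from 1 the integrand is bounded; near 1 it is dominated, against the density, by a multiple
of `(1-a)^(β-s)`, whose exponent exceeds `-1`. These moments control the error in the Gaussian
approximation. -/
lemma integrable_mixingMeasure_one_sub_rpow {ψ : ℝ → ℝ} {β ψ₁ s : ℝ}
    (hψ_meas : AEMeasurable ψ (volume.restrict (Set.Ioo (0 : ℝ) 1)))
    (hψ_nonneg : ∀ x ∈ Set.Ioo (0 : ℝ) 1, 0 ≤ ψ x)
    (hψ_lim : Tendsto ψ (𝓝[<] 1) (𝓝 ψ₁)) [IsFiniteMeasure (mixingMeasure ψ β)]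
    (hs : 0 ≤ s) (hsβ : s < 1 + β) :
    Integrable (fun a => (1 - a) ^ (-s)) (mixingMeasure ψ β) := by
  obtain ⟨δ, hδ, hB⟩ := exists_bound_of_tendsto_left hψ_lim
  rw [← integrableOn_univ, ← Set.Iic_union_Ioi (a := 1 - δ), integrableOn_union]
  constructor
  · refine Integrable.mono' (integrable_const (δ ^ (-s)))
      (by fun_prop : Measurable fun a : ℝ => (1 - a) ^ (-s)).aestronglyMeasurable ?_
    filter_upwards [ae_restrict_mem measurableSet_Iic] with a ha
    have ha' : a ≤ 1 - δ := ha
    have h1 : δ ≤ 1 - a := by linarith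
    rw [Real.norm_of_nonneg (Real.rpow_nonneg (hδ.1.le.trans h1) _)]
    exact Real.rpow_le_rpow_of_nonpos hδ.1 h1 (by linarith)
  · rw [IntegrableOn, restrict_mixingMeasure_Ioi hδ,
      integrable_withDensity_iff_integrable_smul₀']
    · have hi : IntegrableOn (fun a : ℝ => (|ψ₁| + 1) * (1 - a) ^ (β - s)) (Set.Ioo (1 - δ) 1) := by
        refine Integrable.const_mul ?_ _
        have h := integrableOn_Ioo_rpow (r := β - s) (c := δ) (by linarith)
        have := (MeasurePreserving.integrableOn_comp_preimage
          (Measure.measurePreserving_sub_left volume (1 : ℝ)) (MeasurableEquiv.subLeft (1 : ℝ)).measurableEmbedding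
          (f := fun y : ℝ => y ^ (β - s)) (s := Set.Ioo 0 δ)).2 h
        simpa [Function.comp_def, IntegrableOn] using this
      refine hi.mono' ?_ ?_
      · refine AEMeasurable.aestronglyMeasurable ?_
        simp only [smul_eq_mul]
        refine AEMeasurable.mul ?_
          (by fun_prop : Measurable fun a : ℝ => (1 - a) ^ (-s)).aemeasurable
        exact ((aemeasurable_mixing_density hψ_meas).mono_measure
          (Measure.restrict_mono (Ioo_one_sub_subset hδ) le_rfl)).ennreal_toReal
      · filter_upwards [ae_restrict_mem measurableSet_Ioo] with a ha
        have h0 := hψ_nonneg a (Ioo_one_sub_subset hδ ha)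
        have h1a : 0 < 1 - a := by linarith [ha.2]
        have hb := (le_abs_self _).trans (hB a ha)
        rw [ENNReal.toReal_ofReal (by positivity), smul_eq_mul,
          Real.norm_of_nonneg (by positivity), mul_assoc, ← Real.rpow_add h1a, ← sub_eq_add_neg]
        gcongr
    · exact (aemeasurable_mixing_density hψ_meas).mono_measure
        (Measure.restrict_mono (Ioo_one_sub_subset hδ) le_rfl)
    · exact ae_of_all _ fun _ => ENNReal.ofReal_lt_top

/-- Substitution `1 - a = u² y`: the Jacobian contributes `u²` and the factor `(1-a)^β` contributes
`u^{2β}`, which together cancel the normalization. The cut-off at `1 - δ` moves into the indicator,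
so the domain no longer depends on `u`. -/
lemma rescale_integral_near_one {ψ : ℝ → ℝ} {β κ δ u : ℝ} (hu : 0 < u) :
    u ^ (-(2 * (1 + β))) *
        ∫ a in Set.Ioo (1 - δ) 1, ψ a * (1 - a) ^ β * (1 - Real.exp (-(κ * u ^ 2 / (1 - a))))
      = ∫ y in Set.Ioi 0, (Set.Ioo (1 - δ) 1).indicator ψ (1 - u ^ 2 * y)
          * (y ^ β * (1 - Real.exp (-(κ / y)))) := by
  have hu2 : 0 < u ^ 2 := by positivity
  rw [← integral_indicator measurableSet_Ioo, ← integral_indicator measurableSet_Ioi]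
  rw [← integral_sub_left_eq_self _ volume (1 : ℝ)]
  have h := Measure.integral_comp_mul_left (fun x : ℝ => (Set.Ioo (1 - δ) 1).indicator
    (fun a => ψ a * (1 - a) ^ β * (1 - Real.exp (-(κ * u ^ 2 / (1 - a))))) (1 - x)) (u ^ 2)
  rw [abs_of_pos (by positivity), smul_eq_mul] at h
  rw [show ∀ I : ℝ, u ^ (-(2 * (1 + β))) * I = u ^ (-(2 * β)) * ((u ^ 2)⁻¹ * I) by
    intro I
    rw [show -(2 * (1 + β)) = -(2 * β) + -(2 : ℕ) by push_cast; ring, Real.rpow_add hu,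
      Real.rpow_neg hu.le (((2 : ℕ) : ℝ)), Real.rpow_natCast]
    ring, ← h, ← integral_const_mul]
  congr 1
  ext y
  by_cases hy : 0 < y
  · rw [Set.indicator_of_mem (show y ∈ Set.Ioi 0 from hy)]
    by_cases hm : 1 - u ^ 2 * y ∈ Set.Ioo (1 - δ) 1
    · rw [Set.indicator_of_mem hm, Set.indicator_of_mem hm]
      rw [show 1 - (1 - u ^ 2 * y) = u ^ 2 * y by ring, Real.mul_rpow hu2.le hy.le,
        show κ * u ^ 2 / (u ^ 2 * y) = κ / y by field_simp]
      have : u ^ (-(2 * β)) * (u ^ 2) ^ β = 1 := by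
        rw [← Real.rpow_natCast, ← Real.rpow_mul hu.le, ← Real.rpow_add hu]
        simp
      linear_combination (ψ (1 - u ^ 2 * y) * y ^ β * (1 - Real.exp (-(κ / y)))) * this
    · rw [Set.indicator_of_notMem hm, Set.indicator_of_notMem hm]
      simp
  · rw [Set.indicator_of_notMem (show y ∉ Set.Ioi 0 from hy), Set.indicator_of_notMem, mul_zero]
    intro hm
    have := hm.2
    nlinarith

lemma tendsto_integral_near_one {ψ : ℝ → ℝ} {β ψ₁ κ δ : ℝ} (hβ : β ∈ Set.Ioo (-1 : ℝ) 0)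
    (hψ_meas : AEMeasurable ψ (volume.restrict (Set.Ioo (0 : ℝ) 1)))
    (hψ_lim : Tendsto ψ (𝓝[<] 1) (𝓝 ψ₁)) (hκ : 0 ≤ κ) (hδ : δ ∈ Set.Ioo (0 : ℝ) 1)
    (hB : ∀ x ∈ Set.Ioo (1 - δ) 1, |ψ x| ≤ |ψ₁| + 1) :
    Tendsto (fun u : ℝ => ∫ y in Set.Ioi 0,
        (Set.Ioo (1 - δ) 1).indicator ψ (1 - u ^ 2 * y) * (y ^ β * (1 - Real.exp (-(κ / y)))))
      (𝓝[>] 0) (𝓝 (ψ₁ * (κ ^ (1 + β) * (Real.Gamma (-β) / (1 + β))))) := by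
  rw [← integral_Ioi_rpow_mul_one_sub_exp hβ hκ, ← integral_const_mul]
  -- Dominated convergence: `1 - u² y` increases to 1 as `u ↓ 0`, so the indicator factor tends to
  -- `ψ₁` for each `y > 0`, while `|ψ| ≤ |ψ₁| + 1` on the cut-off interval.
  refine tendsto_integral_filter_of_dominated_convergence
    (fun y => (|ψ₁| + 1) * (y ^ β * (1 - Real.exp (-(κ / y))))) ?_ ?_ ?_ ?_
  · filter_upwards [self_mem_nhdsWithin] with u hu
    have hu : 0 < u := hu
    have hm : AEMeasurable ((Set.Ioo (1 - δ) 1).indicator ψ) volume :=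
      (aemeasurable_indicator_iff measurableSet_Ioo).2
        (hψ_meas.mono_measure (Measure.restrict_mono (Ioo_one_sub_subset hδ) le_rfl))
    have hq : Measure.QuasiMeasurePreserving (fun y : ℝ => 1 - u ^ 2 * y) volume volume := by
      refine (Measure.measurePreserving_sub_left volume (1 : ℝ)).quasiMeasurePreserving.comp ?_
      refine ⟨by fun_prop, ?_⟩
      rw [Real.map_volume_mul_left (by positivity)]
      exact Measure.smul_absolutelyContinuous
    refine AEMeasurable.aestronglyMeasurable (AEMeasurable.mul ?_ (by fun_prop))
    exact (hm.comp_quasiMeasurePreserving hq).restrict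
  · filter_upwards with u
    filter_upwards [ae_restrict_mem measurableSet_Ioi] with y hy
    have h := rpow_mul_one_sub_exp_nonneg (β := β) hκ (le_of_lt hy)
    rw [norm_mul, Real.norm_of_nonneg h]
    refine mul_le_mul_of_nonneg_right ?_ h
    by_cases hm : 1 - u ^ 2 * y ∈ Set.Ioo (1 - δ) 1
    · rw [Set.indicator_of_mem hm]
      exact hB _ hm
    · rw [Set.indicator_of_notMem hm, norm_zero]
      positivity
  · exact (integrableOn_Ioi_rpow_mul_one_sub_exp hβ hκ).const_mul _
  · filter_upwards [ae_restrict_mem measurableSet_Ioi] with y hy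
    have hy : 0 < y := hy
    refine Tendsto.mul_const _ ?_
    have h1 : Tendsto (fun u : ℝ => 1 - u ^ 2 * y) (𝓝[>] 0) (𝓝[<] 1) := by
      refine tendsto_nhdsWithin_iff.2 ⟨?_, ?_⟩
      · have : Continuous fun u : ℝ => 1 - u ^ 2 * y := by fun_prop
        have := (this.tendsto 0).mono_left (nhdsWithin_le_nhds (s := Set.Ioi 0))
        simpa using this
      · filter_upwards [self_mem_nhdsWithin] with u hu
        have hu : 0 < u := hu
        have : 0 < u ^ 2 * y := by positivity
        simpa using this
    refine (hψ_lim.comp h1).congr' ?_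
    have : ∀ᶠ x in 𝓝[<] (1 : ℝ), x ∈ Set.Ioo (1 - δ) 1 :=
      Ioo_mem_nhdsLT (by linarith [hδ.1])
    filter_upwards [h1.eventually this] with u hu
    simp [Set.indicator_of_mem hu]

/-- Abelian asymptotics of the Laplace-type transform of the mixing law near `1`. -/
lemma tendsto_rpow_mul_integral_mixingMeasure {ψ : ℝ → ℝ} {β ψ₁ κ : ℝ}
    (hβ : β ∈ Set.Ioo (-1 : ℝ) 0)
    (hψ_meas : AEMeasurable ψ (volume.restrict (Set.Ioo (0 : ℝ) 1)))
    (hψ_nonneg : ∀ x ∈ Set.Ioo (0 : ℝ) 1, 0 ≤ ψ x)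
    (hψ_lim : Tendsto ψ (𝓝[<] 1) (𝓝 ψ₁)) [IsProbabilityMeasure (mixingMeasure ψ β)]
    (hκ : 0 ≤ κ) :
    Tendsto (fun u : ℝ => u ^ (-(2 * (1 + β))) *
        ∫ a, (1 - Real.exp (-(κ * u ^ 2 / (1 - a)))) ∂(mixingMeasure ψ β))
      (𝓝[>] 0) (𝓝 (ψ₁ * (κ ^ (1 + β) * (Real.Gamma (-β) / (1 + β))))) := by
  obtain ⟨δ, hδ, hB⟩ := exists_bound_of_tendsto_left hψ_lim
  have hrange : ∀ u : ℝ, ∀ a ∈ Set.Ioo (0 : ℝ) 1,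
      1 - Real.exp (-(κ * u ^ 2 / (1 - a))) ∈ Set.Icc (0 : ℝ) 1 := by
    intro u a ha
    have : 0 < 1 - a := by linarith [ha.2]
    have h1 : Real.exp (-(κ * u ^ 2 / (1 - a))) ≤ 1 :=
      Real.exp_le_one_iff.2 (by simp only [Left.neg_nonpos_iff]; positivity)
    exact ⟨by linarith, by linarith [Real.exp_pos (-(κ * u ^ 2 / (1 - a)))]⟩
  have hint : ∀ u : ℝ, Integrable (fun a => 1 - Real.exp (-(κ * u ^ 2 / (1 - a))))
      (mixingMeasure ψ β) := by
    intro u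
    refine Integrable.mono' (integrable_const (1 : ℝ))
      (by fun_prop : Measurable fun a : ℝ =>
        1 - Real.exp (-(κ * u ^ 2 / (1 - a)))).aestronglyMeasurable ?_
    filter_upwards [ae_mixingMeasure_mem] with a ha
    rw [Real.norm_of_nonneg (hrange u a ha).1]
    exact (hrange u a ha).2
  -- Away from 1 the integrand is at most `κ u²/δ`, so after normalization this part is
  -- `O(u^{-2β})`, which vanishes because `β < 0`.
  have hlow : Tendsto (fun u : ℝ => u ^ (-(2 * (1 + β))) *
      ∫ a in Set.Iic (1 - δ), (1 - Real.exp (-(κ * u ^ 2 / (1 - a)))) ∂(mixingMeasure ψ β))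
      (𝓝[>] 0) (𝓝 0) := by
    have hlim : Tendsto (fun u : ℝ => u ^ (-(2 * β)) * (κ / δ)) (𝓝[>] 0) (𝓝 0) := by
      have : Tendsto (fun u : ℝ => u ^ (-(2 * β))) (𝓝[>] 0) (𝓝 (0 ^ (-(2 * β)))) :=
        ((Real.continuousAt_rpow_const 0 (-(2 * β)) (Or.inr (by linarith [hβ.2]))).tendsto).mono_left
          nhdsWithin_le_nhds
      rw [Real.zero_rpow (by linarith [hβ.2])] at this
      simpa using this.mul_const (κ / δ)
    refine squeeze_zero' ?_ ?_ hlim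
    · filter_upwards [self_mem_nhdsWithin] with u hu
      refine mul_nonneg (Real.rpow_nonneg (le_of_lt hu) _) (integral_nonneg_of_ae ?_)
      filter_upwards [ae_restrict_of_ae ae_mixingMeasure_mem] with a ha using (hrange u a ha).1
    · filter_upwards [self_mem_nhdsWithin] with u hu
      have hu : 0 < u := hu
      have hle : ∫ a in Set.Iic (1 - δ), (1 - Real.exp (-(κ * u ^ 2 / (1 - a))))
          ∂(mixingMeasure ψ β) ≤ κ * u ^ 2 / δ := by
        calc _ ≤ ∫ a in Set.Iic (1 - δ), κ * u ^ 2 / δ ∂(mixingMeasure ψ β) := by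
              refine integral_mono_ae (hint u).integrableOn (integrable_const _) ?_
              filter_upwards [ae_restrict_mem measurableSet_Iic] with a ha
              have ha : a ≤ 1 - δ := ha
              have h1 := Real.one_sub_le_exp_neg (κ * u ^ 2 / (1 - a))
              have h2 : κ * u ^ 2 / (1 - a) ≤ κ * u ^ 2 / δ := by
                have := hδ.1
                gcongr
                linarith
              linarith
          _ ≤ κ * u ^ 2 / δ := by
              rw [integral_const, smul_eq_mul]
              have := hδ.1
              refine mul_le_of_le_one_left (by positivity) ?_
              rw [measureReal_restrict_apply_univ]
              exact measureReal_le_one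
      calc _ ≤ u ^ (-(2 * (1 + β))) * (κ * u ^ 2 / δ) := by gcongr
        _ = u ^ (-(2 * β)) * (κ / δ) := by
          rw [show -(2 * β) = -(2 * (1 + β)) + (2 : ℕ) by push_cast; ring, Real.rpow_add hu,
            Real.rpow_natCast]
          ring
  have hhigh := tendsto_integral_near_one hβ hψ_meas hψ_lim hκ hδ hB
  have := hlow.add hhigh
  rw [zero_add] at this
  refine this.congr' ?_
  filter_upwards [self_mem_nhdsWithin] with u hu
  rw [← rescale_integral_near_one hu, ← setIntegral_mixingMeasure_Ioi hδ hψ_meas hψ_nonneg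
    (fun a => 1 - Real.exp (-(κ * u ^ 2 / (1 - a)))), ← mul_add]
  congr 1
  rw [← setIntegral_union (Set.Iic_disjoint_Ioi le_rfl) measurableSet_Ioi
    (hint u).integrableOn (hint u).integrableOn, Set.Iic_union_Ioi, setIntegral_univ]

/-! ### Moments of Poisson and Bernoulli variables -/

lemma hasSum_poisson_id (r : ℝ≥0) :
    HasSum (fun n : ℕ => Real.exp (-r) * r ^ n / n.factorial * (n : ℝ)) r := by
  rw [← hasSum_nat_add_iff' 1]
  have h := (hasSum_one_poissonMeasure r).mul_left (r : ℝ)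
  simp only [Finset.range_one, Finset.sum_singleton, Nat.cast_zero, mul_zero, sub_zero]
  rw [mul_one] at h
  refine h.congr_fun fun n => ?_
  rw [Nat.factorial_succ]
  push_cast
  have : (n.factorial : ℝ) ≠ 0 := by positivity
  field_simp
  ring

lemma hasSum_poisson_descFactorial_two (r : ℝ≥0) :
    HasSum (fun n : ℕ => Real.exp (-r) * r ^ n / n.factorial * ((n : ℝ) * (n - 1))) (r ^ 2) := by
  rw [← hasSum_nat_add_iff' 2]
  have h := (hasSum_one_poissonMeasure r).mul_left ((r : ℝ) ^ 2)
  rw [mul_one] at h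
  simp only [Finset.sum_range_succ, Finset.range_zero, Finset.sum_empty, Nat.cast_zero,
    zero_mul, mul_zero, Nat.cast_one, sub_self, add_zero, sub_zero]
  refine h.congr_fun fun n => ?_
  rw [Nat.factorial_succ, Nat.factorial_succ]
  push_cast
  have : (n.factorial : ℝ) ≠ 0 := by positivity
  field_simp
  ring

lemma hasSum_poisson_sq (r : ℝ≥0) :
    HasSum (fun n : ℕ => Real.exp (-r) * r ^ n / n.factorial * (n : ℝ) ^ 2) (r ^ 2 + r) := by
  refine ((hasSum_poisson_descFactorial_two r).add (hasSum_poisson_id r)).congr_fun fun n => ?_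
  ring

lemma memLp_poissonMeasure (r : ℝ≥0) : MemLp (fun n : ℕ => (n : ℝ)) 2 (poissonMeasure r) := by
  rw [memLp_two_iff_integrable_sq (by fun_prop), integrable_poissonMeasure_iff]
  simpa using (hasSum_poisson_sq r).summable

lemma integral_id_poissonMeasure (r : ℝ≥0) : ∫ n, (n : ℝ) ∂(poissonMeasure r) = r := by
  rw [integral_poissonMeasure]
  simpa using (hasSum_poisson_id r).tsum_eq

lemma integral_sq_poissonMeasure (r : ℝ≥0) :
    ∫ n, (n : ℝ) ^ 2 ∂(poissonMeasure r) = r ^ 2 + r := by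
  rw [integral_poissonMeasure]
  simpa using (hasSum_poisson_sq r).tsum_eq

lemma variance_poissonMeasure (r : ℝ≥0) :
    variance (fun n : ℕ => (n : ℝ)) (poissonMeasure r) = r := by
  rw [variance_eq_sub (memLp_poissonMeasure r), integral_id_poissonMeasure]
  simp only [Pi.pow_apply]
  rw [integral_sq_poissonMeasure]
  ring

lemma map_eq_poissonMeasure {Ω : Type*} [MeasurableSpace Ω] {Q : Measure Ω} [IsFiniteMeasure Q]
    {Y : Ω → ℕ} (hY : Measurable Y) {r : ℝ} (hr : 0 ≤ r)
    (h : ∀ l : ℕ, Q.real (Y ⁻¹' {l}) = r ^ l / l.factorial * Real.exp (-r)) :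
    Q.map Y = poissonMeasure r.toNNReal := by
  refine Measure.ext_of_singleton fun l => ?_
  rw [poissonMeasure_singleton, Measure.map_apply hY (measurableSet_singleton l),
    ← ofReal_measureReal, h, Real.coe_toNNReal r hr]
  congr 1
  ring

section PoissonLaw

variable {Ω : Type*} [MeasurableSpace Ω] {Q : Measure Ω} {Y : Ω → ℕ} {r : ℝ≥0}

lemma memLp_of_map_eq_poissonMeasure (hY : Measurable Y) (h : Q.map Y = poissonMeasure r) :
    MemLp (fun ω => (Y ω : ℝ)) 2 Q := by
  have := memLp_poissonMeasure r
  rw [← h] at this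
  exact (memLp_map_measure_iff (by fun_prop) hY.aemeasurable).1 this

lemma integral_of_map_eq_poissonMeasure (hY : Measurable Y) (h : Q.map Y = poissonMeasure r) :
    ∫ ω, (Y ω : ℝ) ∂Q = r := by
  rw [← integral_id_poissonMeasure, ← h, integral_map hY.aemeasurable (by fun_prop)]

lemma variance_of_map_eq_poissonMeasure (hY : Measurable Y) (h : Q.map Y = poissonMeasure r) :
    variance (fun ω => (Y ω : ℝ)) Q = r := by
  rw [← variance_poissonMeasure, ← h, variance_map (by fun_prop) hY.aemeasurable]
  rfl

end PoissonLaw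

section BernoulliLaw

variable {Ω : Type*} [MeasurableSpace Ω] {Q : Measure Ω} [IsProbabilityMeasure Q] {Y : Ω → ℕ}
  {a : ℝ}

lemma ae_eq_indicator_of_bernoulli (hY : Measurable Y) (h1 : Q.real (Y ⁻¹' {1}) = a)
    (h0 : Q.real (Y ⁻¹' {0}) = 1 - a) :
    (fun ω => (Y ω : ℝ)) =ᵐ[Q] (Y ⁻¹' {1}).indicator 1 := by
  have hm : ∀ l, MeasurableSet (Y ⁻¹' {l}) := fun l => hY (measurableSet_singleton l)
  have hu : Q.real (Y ⁻¹' {0} ∪ Y ⁻¹' {1}) = 1 := by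
    rw [measureReal_union _ (hm 1), h0, h1]
    · ring
    · exact Disjoint.preimage _ (by simp)
  have : ∀ᵐ ω ∂Q, ω ∈ Y ⁻¹' {0} ∪ Y ⁻¹' {1} := by
    rw [measureReal_def] at hu
    refine (mem_ae_iff_prob_eq_one ((hm 0).union (hm 1))).2 ?_
    exact (ENNReal.toReal_eq_one_iff _).1 hu
  filter_upwards [this] with ω hω
  rcases hω with hω | hω
  · have hω : Y ω = 0 := hω
    simp [Set.indicator, hω]
  · have hω : Y ω = 1 := hω
    simp [Set.indicator, hω]

lemma memLp_of_bernoulli (hY : Measurable Y) (h1 : Q.real (Y ⁻¹' {1}) = a)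
    (h0 : Q.real (Y ⁻¹' {0}) = 1 - a) : MemLp (fun ω => (Y ω : ℝ)) 2 Q := by
  rw [memLp_congr_ae (ae_eq_indicator_of_bernoulli hY h1 h0)]
  exact (memLp_const (1 : ℝ)).indicator (hY (measurableSet_singleton 1))

lemma integral_of_bernoulli (hY : Measurable Y) (h1 : Q.real (Y ⁻¹' {1}) = a)
    (h0 : Q.real (Y ⁻¹' {0}) = 1 - a) : ∫ ω, (Y ω : ℝ) ∂Q = a := by
  rw [integral_congr_ae (ae_eq_indicator_of_bernoulli hY h1 h0),
    integral_indicator_one (hY (measurableSet_singleton 1)), h1]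

lemma variance_of_bernoulli (hY : Measurable Y) (h1 : Q.real (Y ⁻¹' {1}) = a)
    (h0 : Q.real (Y ⁻¹' {0}) = 1 - a) : variance (fun ω => (Y ω : ℝ)) Q = a * (1 - a) := by
  rw [variance_eq_sub (memLp_of_bernoulli hY h1 h0), integral_of_bernoulli hY h1 h0]
  have : ((fun ω => (Y ω : ℝ)) ^ 2) =ᵐ[Q] (Y ⁻¹' {1}).indicator 1 := by
    filter_upwards [ae_eq_indicator_of_bernoulli hY h1 h0] with ω hω
    rw [Pi.pow_apply, hω]
    by_cases h : ω ∈ Y ⁻¹' {1} <;> simp [Set.indicator, h]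
  rw [integral_congr_ae this, integral_indicator_one (hY (measurableSet_singleton 1)), h1]
  ring

end BernoulliLaw

/-! ### The chain with a deterministic parameter: Markov step and second moments -/

/-- `Z` are the primitive variables of a stationary INAR(1) process with deterministic thinning
parameter `a` and Poisson(`lam`) innovations. -/
structure IsInar {Ω : Type*} [MeasurableSpace Ω] (Q : Measure Ω) (lam a : ℝ)
    (Z : InarIndex → Ω → ℕ) : Prop where
  measurable : ∀ i, Measurable (Z i)
  indep : iIndepFun Z Q
  offspring_one : ∀ k i, Q.real (Z (.offspring k i) ⁻¹' {1}) = a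
  offspring_zero : ∀ k i, Q.real (Z (.offspring k i) ⁻¹' {0}) = 1 - a
  innov_poisson : ∀ k l : ℕ,
    Q.real (Z (.innov k) ⁻¹' {l}) = lam ^ l / l.factorial * Real.exp (-lam)
  init_poisson : ∀ l : ℕ,
    Q.real (Z .init ⁻¹' {l}) = (lam / (1 - a)) ^ l / l.factorial * Real.exp (-(lam / (1 - a)))

/-- The first time at which a primitive variable influences the process. -/
def InarIndex.level : InarIndex → ℕ
  | .init => 0
  | .innov k => k + 1
  | .offspring k _ => k + 1

/-- The σ-algebra `m` is arbitrary so that the one generated by the variables of level at most `k`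
can be inserted; this is adaptedness. -/
lemma measurable_inarProcess {Ω : Type*} {m : MeasurableSpace Ω} {Z : InarIndex → Ω → ℕ} {k : ℕ}
    (h : ∀ i : InarIndex, i.level ≤ k → Measurable (Z i)) : Measurable (inarProcess Z k) := by
  induction k with
  | zero => exact h .init le_rfl
  | succ k ih =>
    have hX : Measurable (inarProcess Z k) := ih fun i hi => h i (hi.trans (Nat.le_succ k))
    have hS : Measurable fun p : ℕ × Ω => ∑ i ∈ Finset.range p.1, Z (.offspring k i) p.2 := by
      refine measurable_from_prod_countable_right fun x => ?_
      exact Finset.measurable_fun_sum (Finset.range x) fun i _ => h (.offspring k i) le_rfl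
    exact (hS.comp (hX.prodMk measurable_id)).add (h (.innov k) le_rfl)

/-- One step of the process started from the value `x` at time `k`. -/
def inarStep {Ω : Type*} (Z : InarIndex → Ω → ℕ) (k x : ℕ) (ω : Ω) : ℕ :=
  ∑ i ∈ Finset.range x, Z (.offspring k i) ω + Z (.innov k) ω

lemma measurable_inarStep {Ω : Type*} {m : MeasurableSpace Ω} {Z : InarIndex → Ω → ℕ} {k : ℕ}
    (h : ∀ i : InarIndex, k < i.level → Measurable (Z i)) (x : ℕ) :
    Measurable (inarStep Z k x) :=
  (Finset.measurable_fun_sum _ fun i _ => h (.offspring k i) (Nat.lt_succ_self k)).add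
    (h (.innov k) (Nat.lt_succ_self k))

/-- Freezing: split according to the countably many values of `X`. On `X = x` only `U x` matters, so
independence of `X` from each single `U x` suffices. -/
lemma lintegral_comp_of_indepFun {Ω : Type*} [MeasurableSpace Ω] {Q : Measure Ω}
    [IsProbabilityMeasure Q] {X : Ω → ℕ} {U : ℕ → Ω → ℕ} (hX : Measurable X)
    (hU : ∀ x, Measurable (U x)) (h : ∀ x, IndepFun X (U x) Q) (g : ℕ → ℕ → ℝ≥0∞) :
    ∫⁻ ω, g (X ω) (U (X ω) ω) ∂Q = ∫⁻ ω, ∫⁻ ω', g (X ω) (U (X ω) ω') ∂Q ∂Q := by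
  have hind : ∀ x, Measurable fun ω => ({x} : Set ℕ).indicator (1 : ℕ → ℝ≥0∞) (X ω) :=
    fun x => (measurable_of_countable (({x} : Set ℕ).indicator (1 : ℕ → ℝ≥0∞))).comp hX
  have split : ∀ (f : ℕ → Ω → ℝ≥0∞), (∀ x, Measurable (f x)) →
      ∫⁻ ω, f (X ω) ω ∂Q = ∑' x, ∫⁻ ω, ({x} : Set ℕ).indicator 1 (X ω) * f x ω ∂Q := by
    intro f hf
    rw [← lintegral_tsum]
    · refine lintegral_congr fun ω => ?_
      rw [tsum_eq_single (X ω)]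
      · simp
      · intro x hx
        simp [Set.indicator, hx.symm]
    · intro x
      exact ((hind x).mul (hf x)).aemeasurable
  rw [split (fun x ω => g x (U x ω)) fun x => (measurable_of_countable (g x)).comp (hU x),
    split (fun x _ => ∫⁻ ω', g x (U x ω') ∂Q) fun x => measurable_const]
  congr 1
  ext x
  rw [lintegral_mul_const _ (hind x)]
  exact lintegral_mul_eq_lintegral_mul_lintegral_of_indepFun''
    (hind x).aemeasurable
    ((measurable_of_countable (g x)).comp (hU x)).aemeasurable
    ((h x).comp (φ := ({x} : Set ℕ).indicator (1 : ℕ → ℝ≥0∞)) (ψ := g x)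
      (measurable_of_countable _) (measurable_of_countable _))

lemma integrable_and_integral_of_lintegral_eq {Ω : Type*} [MeasurableSpace Ω] {Q : Measure Ω}
    {f : Ω → ℝ} {c : ℝ} (hf : Measurable f) (hf0 : ∀ ω, 0 ≤ f ω) (hc : 0 ≤ c)
    (h : ∫⁻ ω, ENNReal.ofReal (f ω) ∂Q = ENNReal.ofReal c) :
    Integrable f Q ∧ ∫ ω, f ω ∂Q = c := by
  constructor
  · refine (lintegral_ofReal_ne_top_iff_integrable hf.aestronglyMeasurable (ae_of_all _ hf0)).1 ?_
    rw [h]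
    exact ENNReal.ofReal_ne_top
  · rw [integral_eq_lintegral_of_nonneg_ae (ae_of_all _ hf0) hf.aestronglyMeasurable, h,
      ENNReal.toReal_ofReal hc]

lemma integrable_and_integral_quadratic {Ω : Type*} [MeasurableSpace Ω] {Q : Measure Ω}
    [IsProbabilityMeasure Q] {X : Ω → ℝ} {m μ₁ μ₂ : ℝ} (hX : Integrable X Q)
    (hX2 : Integrable (fun ω => (X ω - m) ^ 2) Q) (h1 : ∫ ω, X ω ∂Q = μ₁)
    (h2 : ∫ ω, (X ω - m) ^ 2 ∂Q = μ₂) (p l c : ℝ) :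
    Integrable (fun ω => p * X ω + l + c * (X ω - m) ^ 2) Q ∧
      ∫ ω, (p * X ω + l + c * (X ω - m) ^ 2) ∂Q = p * μ₁ + l + c * μ₂ := by
  have e1 : Integrable (fun ω => p * X ω + l) Q := (hX.const_mul p).add (integrable_const l)
  refine ⟨e1.add (hX2.const_mul c), ?_⟩
  rw [integral_add e1 (hX2.const_mul c), integral_add (hX.const_mul p) (integrable_const l),
    integral_const_mul, integral_const_mul, h1, h2]
  simp

namespace IsInar

variable {Ω : Type*} [MeasurableSpace Ω] {Q : Measure Ω} [IsProbabilityMeasure Q] {lam a : ℝ}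
  {Z : InarIndex → Ω → ℕ}

/-- The two sides are functions of primitive variables with disjoint index sets: levels at most `k`,
and levels above `k`. -/
lemma indepFun_inarProcess_inarStep {Ω : Type*} [MeasurableSpace Ω] {Q : Measure Ω} {lam a : ℝ}
    {Z : InarIndex → Ω → ℕ} (hZ : IsInar Q lam a Z) (k x : ℕ) :
    IndepFun (inarProcess Z k) (inarStep Z k x) Q := by
  have h := indep_iSup_of_disjoint (fun i => (hZ.measurable i).comap_le)
    ((iIndepFun_iff_iIndep _ _ _).1 hZ.indep)
    (S := {i : InarIndex | i.level ≤ k}) (T := {i : InarIndex | k < i.level})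
    (Set.disjoint_left.2 fun i hi hi' => (not_le.2 hi' : ¬ i.level ≤ k) hi)
  rw [IndepFun_iff_Indep]
  refine indep_of_indep_of_le_left (indep_of_indep_of_le_right h ?_) ?_
  · refine Measurable.comap_le ?_
    refine measurable_inarStep (fun i hi => ?_) x
    exact Measurable.of_comap_le (le_iSup₂_of_le i hi le_rfl)
  · refine Measurable.comap_le ?_
    refine measurable_inarProcess fun i hi => ?_
    exact Measurable.of_comap_le (le_iSup₂_of_le i hi le_rfl)

lemma map_innov (hZ : IsInar Q lam a Z) (hlam : 0 < lam) (k : ℕ) :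
    Q.map (Z (.innov k)) = poissonMeasure lam.toNNReal :=
  map_eq_poissonMeasure (hZ.measurable _) hlam.le (hZ.innov_poisson k)

lemma map_init (hZ : IsInar Q lam a Z) (hlam : 0 < lam) (ha : a ∈ Set.Ioo (0 : ℝ) 1) :
    Q.map (Z .init) = poissonMeasure (lam / (1 - a)).toNNReal := by
  have : 0 < 1 - a := by linarith [ha.2]
  exact map_eq_poissonMeasure (hZ.measurable _) (by positivity) hZ.init_poisson

lemma memLp_offspring (hZ : IsInar Q lam a Z) (k i : ℕ) :
    MemLp (fun ω => (Z (.offspring k i) ω : ℝ)) 2 Q :=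
  memLp_of_bernoulli (hZ.measurable _) (hZ.offspring_one k i) (hZ.offspring_zero k i)

lemma memLp_innov (hZ : IsInar Q lam a Z) (hlam : 0 < lam) (k : ℕ) :
    MemLp (fun ω => (Z (.innov k) ω : ℝ)) 2 Q :=
  memLp_of_map_eq_poissonMeasure (hZ.measurable _) (hZ.map_innov hlam k)

/-- The primitive variables used in one step from the value `x` at time `k`. -/
noncomputable def stepIndices (k x : ℕ) : Finset InarIndex := by
  classical exact insert (.innov k) ((Finset.range x).image (.offspring k))

lemma sum_stepIndices {M : Type*} [AddCommMonoid M] (f : InarIndex → M) (k x : ℕ) :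
    ∑ j ∈ stepIndices k x, f j = ∑ i ∈ Finset.range x, f (.offspring k i) + f (.innov k) := by
  classical
  rw [stepIndices, Finset.sum_insert (by simp), Finset.sum_image (by simp), add_comm]

lemma memLp_of_mem_stepIndices (hZ : IsInar Q lam a Z) (hlam : 0 < lam) {k x : ℕ} {j : InarIndex}
    (hj : j ∈ stepIndices k x) : MemLp (fun ω => (Z j ω : ℝ)) 2 Q := by
  classical
  simp only [stepIndices, Finset.mem_insert, Finset.mem_image, Finset.mem_range] at hj
  rcases hj with rfl | ⟨i, -, rfl⟩
  · exact hZ.memLp_innov hlam k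
  · exact hZ.memLp_offspring k i

lemma inarStep_cast {Ω : Type*} {Z : InarIndex → Ω → ℕ} (k x : ℕ) :
    (fun ω => (inarStep Z k x ω : ℝ)) = ∑ j ∈ stepIndices k x, fun ω => (Z j ω : ℝ) := by
  ext ω
  rw [sum_stepIndices]
  simp [inarStep]

lemma memLp_inarStep (hZ : IsInar Q lam a Z) (hlam : 0 < lam) (k x : ℕ) :
    MemLp (fun ω => (inarStep Z k x ω : ℝ)) 2 Q := by
  rw [inarStep_cast]
  exact memLp_finsetSum' _ fun j hj => hZ.memLp_of_mem_stepIndices hlam hj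

lemma integral_inarStep (hZ : IsInar Q lam a Z) (hlam : 0 < lam) (k x : ℕ) :
    ∫ ω, (inarStep Z k x ω : ℝ) ∂Q = a * x + lam := by
  have : ∀ ω, (inarStep Z k x ω : ℝ) = ∑ j ∈ stepIndices k x, (Z j ω : ℝ) := fun ω => by
    simpa using congrFun (inarStep_cast (Z := Z) k x) ω
  simp_rw [this]
  rw [integral_finsetSum _ fun j hj =>
    (hZ.memLp_of_mem_stepIndices hlam hj).integrable one_le_two, sum_stepIndices]
  rw [integral_of_map_eq_poissonMeasure (hZ.measurable _) (hZ.map_innov hlam k)]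
  simp only [integral_of_bernoulli (hZ.measurable _) (hZ.offspring_one k _)
    (hZ.offspring_zero k _), Finset.sum_const, Finset.card_range, nsmul_eq_mul,
    Real.coe_toNNReal _ hlam.le]
  ring

lemma variance_inarStep (hZ : IsInar Q lam a Z) (hlam : 0 < lam) (k x : ℕ) :
    variance (fun ω => (inarStep Z k x ω : ℝ)) Q = a * (1 - a) * x + lam := by
  rw [inarStep_cast, IndepFun.variance_sum fun j hj => hZ.memLp_of_mem_stepIndices hlam hj,
    sum_stepIndices]
  · rw [variance_of_map_eq_poissonMeasure (hZ.measurable _) (hZ.map_innov hlam k)]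
    simp only [variance_of_bernoulli (hZ.measurable _) (hZ.offspring_one k _)
      (hZ.offspring_zero k _), Finset.sum_const, Finset.card_range, nsmul_eq_mul,
      Real.coe_toNNReal _ hlam.le]
    ring
  · intro i _ j _ hij
    exact (hZ.indep.indepFun hij).comp (φ := fun n : ℕ => (n : ℝ)) (ψ := fun n : ℕ => (n : ℝ))
      (by fun_prop) (by fun_prop)

lemma integral_inarStep_sub_sq (hZ : IsInar Q lam a Z) (hlam : 0 < lam) (k x : ℕ) (c : ℝ) :
    ∫ ω, ((inarStep Z k x ω : ℝ) - c) ^ 2 ∂Q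
      = a * (1 - a) * x + lam + (a * x + lam - c) ^ 2 := by
  have hm := hZ.memLp_inarStep hlam k x
  have hmc : MemLp (fun ω => (inarStep Z k x ω : ℝ) - c) 2 Q := hm.sub (memLp_const c)
  have hv := variance_eq_sub hmc
  rw [variance_sub_const hm.aestronglyMeasurable, hZ.variance_inarStep hlam,
    integral_sub (hm.integrable one_le_two) (integrable_const c), hZ.integral_inarStep hlam] at hv
  simp only [Pi.pow_apply, integral_const, probReal_univ, one_smul] at hv
  linarith

/-- The Markov property in integrated form. Since `g` is nonnegative, the computation is done with
Lebesgue integrals, and integrability of the left side follows from that of `q`. -/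
lemma integral_comp_succ (hZ : IsInar Q lam a Z) (k : ℕ) {g : ℕ → ℕ → ℝ} {q : ℕ → ℝ}
    (hg : ∀ x y, 0 ≤ g x y) (hgi : ∀ x, Integrable (fun ω => g x (inarStep Z k x ω)) Q)
    (hgq : ∀ x, ∫ ω, g x (inarStep Z k x ω) ∂Q = q x)
    (hq : Integrable (fun ω => q (inarProcess Z k ω)) Q) :
    Integrable (fun ω => g (inarProcess Z k ω) (inarProcess Z (k + 1) ω)) Q ∧
      ∫ ω, g (inarProcess Z k ω) (inarProcess Z (k + 1) ω) ∂Q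
        = ∫ ω, q (inarProcess Z k ω) ∂Q := by
  have hX : ∀ k, Measurable (inarProcess Z k) :=
    fun k => measurable_inarProcess fun i _ => hZ.measurable i
  have hq0 : ∀ x, 0 ≤ q x := fun x => by
    rw [← hgq x]
    exact integral_nonneg fun ω => hg _ _
  refine integrable_and_integral_of_lintegral_eq ?_ (fun ω => hg _ _)
    (integral_nonneg fun ω => hq0 _) ?_
  · exact (measurable_of_countable (Function.uncurry g)).comp ((hX k).prodMk (hX (k + 1)))
  · have := lintegral_comp_of_indepFun (Q := Q) (hX k)
      (fun x => measurable_inarStep (fun i _ => hZ.measurable i) x)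
      (hZ.indepFun_inarProcess_inarStep k) (fun x y => ENNReal.ofReal (g x y))
    -- `inarProcess Z (k + 1) ω` is by definition `inarStep Z k (inarProcess Z k ω) ω`.
    refine this.trans ?_
    rw [ofReal_integral_eq_lintegral_ofReal hq (ae_of_all _ fun ω => hq0 _)]
    refine lintegral_congr fun ω => ?_
    rw [← hgq, ofReal_integral_eq_lintegral_ofReal (hgi _) (ae_of_all _ fun ω => hg _ _)]

/-- The process is second-order stationary, with mean and variance `lam / (1 - a)`. -/
lemma moments (hZ : IsInar Q lam a Z) (hlam : 0 < lam) (ha : a ∈ Set.Ioo (0 : ℝ) 1) (k : ℕ) :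
    MemLp (fun ω => (inarProcess Z k ω : ℝ)) 2 Q ∧
      ∫ ω, (inarProcess Z k ω : ℝ) ∂Q = lam / (1 - a) ∧
      ∫ ω, ((inarProcess Z k ω : ℝ) - lam / (1 - a)) ^ 2 ∂Q = lam / (1 - a) := by
  have h1a : 0 < 1 - a := by linarith [ha.2]
  have hX : ∀ k, Measurable (inarProcess Z k) :=
    fun k => measurable_inarProcess fun i _ => hZ.measurable i
  set m := lam / (1 - a) with hm
  have hm0 : 0 ≤ m := by positivity
  have hma : a * m + lam = m := by rw [hm]; field_simp; ring
  induction k with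
  | zero =>
    have hY := hZ.measurable .init
    have h := hZ.map_init hlam ha
    refine ⟨memLp_of_map_eq_poissonMeasure hY h, ?_, ?_⟩
    · exact (integral_of_map_eq_poissonMeasure hY h).trans (Real.coe_toNNReal _ hm0)
    · have hv := variance_of_map_eq_poissonMeasure hY h
      rw [variance_eq_integral (by fun_prop), integral_of_map_eq_poissonMeasure hY h,
        Real.coe_toNNReal _ hm0] at hv
      exact hv
  | succ k ih =>
    obtain ⟨i1, i2, i3⟩ := ih
    have hint := i1.integrable one_le_two
    have hintc : Integrable (fun ω => ((inarProcess Z k ω : ℝ) - m) ^ 2) Q :=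
      (i1.sub (memLp_const m)).integrable_sq
    obtain ⟨-, e1⟩ := hZ.integral_comp_succ k (g := fun _ y => (y : ℝ)) (q := fun x => a * x + lam)
      (fun _ _ => by positivity)
      (fun x => (hZ.memLp_inarStep hlam k x).integrable one_le_two)
      (fun x => hZ.integral_inarStep hlam k x) ((hint.const_mul a).add (integrable_const lam))
    obtain ⟨q1, q2⟩ := integrable_and_integral_quadratic hint hintc i2 i3 (a * (1 - a)) lam (a ^ 2)
    -- As `m` is the fixed point of `x ↦ a x + lam`, deviations from it shrink by the factor `a`;
    -- the variance then stays at `a(1-a)m + lam + a² m = m`.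
    have this : ∀ x : ℝ, a * (1 - a) * x + lam + (a * x + lam - m) ^ 2
        = a * (1 - a) * x + lam + a ^ 2 * (x - m) ^ 2 := by
      intro x
      rw [show a * x + lam - m = a * (x - m) by linear_combination hma]
      ring
    obtain ⟨s1, s2⟩ := hZ.integral_comp_succ k (g := fun _ y => ((y : ℝ) - m) ^ 2)
      (q := fun x => a * (1 - a) * x + lam + a ^ 2 * (x - m) ^ 2)
      (fun _ _ => by positivity)
      (fun x => ((hZ.memLp_inarStep hlam k x).sub (memLp_const m)).integrable_sq)
      (fun x => by rw [hZ.integral_inarStep_sub_sq hlam k x m, this]) q1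
    refine ⟨?_, ?_, ?_⟩
    · have h2 : MemLp (fun ω => (inarProcess Z (k + 1) ω : ℝ) - m) 2 Q :=
        (memLp_two_iff_integrable_sq (by have := hX (k + 1); fun_prop)).2 s1
      refine (h2.add (memLp_const m)).ae_eq (ae_of_all _ fun ω => ?_)
      simp
    · rw [e1, integral_add (hint.const_mul a) (integrable_const lam), integral_const_mul, i2]
      simpa using hma
    · rw [s2, q2]
      linear_combination hma

/-- Conditioning on `X_k` gives `a(1-a)m + lam + (1-a)² m = (1-a)m + lam`, and `(1-a)m = lam`. The
blow-up of the variance `m` as `a → 1` cancels, so increments are bounded in `L²` uniformly in `a`.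
-/
lemma integral_succ_sub_sq (hZ : IsInar Q lam a Z) (hlam : 0 < lam)
    (ha : a ∈ Set.Ioo (0 : ℝ) 1) (k : ℕ) :
    ∫ ω, ((inarProcess Z (k + 1) ω : ℝ) - inarProcess Z k ω) ^ 2 ∂Q = 2 * lam := by
  have h1a : 0 < 1 - a := by linarith [ha.2]
  obtain ⟨i1, i2, i3⟩ := hZ.moments hlam ha k
  set m := lam / (1 - a) with hm
  have hma : (1 - a) * m = lam := by rw [hm]; field_simp
  have hint := i1.integrable one_le_two
  have hintc : Integrable (fun ω => ((inarProcess Z k ω : ℝ) - m) ^ 2) Q :=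
    (i1.sub (memLp_const m)).integrable_sq
  have this : ∀ x : ℝ, a * (1 - a) * x + lam + (a * x + lam - x) ^ 2
      = a * (1 - a) * x + lam + (1 - a) ^ 2 * (x - m) ^ 2 := by
    intro x
    rw [show a * x + lam - x = -((1 - a) * (x - m)) by linear_combination -hma]
    ring
  obtain ⟨q1, q2⟩ := integrable_and_integral_quadratic hint hintc i2 i3 (a * (1 - a)) lam
    ((1 - a) ^ 2)
  obtain ⟨-, s2⟩ := hZ.integral_comp_succ k (g := fun x y => ((y : ℝ) - x) ^ 2)
    (q := fun x => a * (1 - a) * x + lam + (1 - a) ^ 2 * (x - m) ^ 2)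
    (fun _ _ => by positivity)
    (fun x => ((hZ.memLp_inarStep hlam k x).sub (memLp_const (x : ℝ))).integrable_sq)
    (fun x => by rw [hZ.integral_inarStep_sub_sq hlam k x x, this])
    q1
  rw [s2, q2]
  linear_combination hma

end IsInar

/-! ### Estimates for complex exponentials and characteristic functions -/

/-- Taylor's remainder with `e ≤ 3` for `|x| ≤ 1`, and the triangle inequality beyond. The constant
is crude, but the bound holds for all `x`, so no truncation is needed later. -/
lemma norm_exp_mul_I_sub_one_sub_le (x : ℝ) :
    ‖Complex.exp (x * Complex.I) - 1 - x * Complex.I‖ ≤ 3 * x ^ 2 := by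
  rcases le_or_gt |x| 1 with hx | hx
  · have h := Complex.norm_exp_sub_sum_le_norm_mul_exp (x * Complex.I) 2
    simp only [Finset.sum_range_succ, Finset.range_zero, Finset.sum_empty, pow_zero, pow_one,
      Nat.factorial, Nat.cast_one, div_one, zero_add, mul_one, norm_mul, Complex.norm_real,
      Complex.norm_I, Real.norm_eq_abs, sq_abs] at h
    rw [sub_sub]
    refine h.trans ?_
    have : Real.exp |x| ≤ 3 :=
      (Real.exp_le_exp.2 hx).trans (by linarith [Real.exp_one_lt_d9])
    nlinarith [sq_nonneg x]
  · calc _ ≤ ‖Complex.exp (x * Complex.I)‖ + ‖(1 : ℂ)‖ + ‖(x * Complex.I : ℂ)‖ :=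
          (norm_sub_le _ _).trans (by gcongr; exact norm_sub_le _ _)
      _ = 2 + |x| := by
          rw [Complex.norm_exp_ofReal_mul_I]
          simp
          norm_num
      _ ≤ 3 * x ^ 2 := by nlinarith [sq_abs x]

lemma norm_exp_mul_I_sub_taylor_two_le (x : ℝ) :
    ‖Complex.exp (x * Complex.I) - 1 - x * Complex.I + x ^ 2 / 2‖ ≤ 4 * |x| ^ 3 := by
  rcases le_or_gt |x| 1 with hx | hx
  · have h := Complex.norm_exp_sub_sum_le_norm_mul_exp (x * Complex.I) 3
    have e : Complex.exp (x * Complex.I) - 1 - x * Complex.I + x ^ 2 / 2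
        = Complex.exp (x * Complex.I)
          - ∑ m ∈ Finset.range 3, (x * Complex.I) ^ m / (m.factorial : ℂ) := by
      simp [Finset.sum_range_succ, Nat.factorial, mul_pow]
      ring
    rw [e]
    refine h.trans ?_
    have h3 : Real.exp |x| ≤ 3 :=
      (Real.exp_le_exp.2 hx).trans (by linarith [Real.exp_one_lt_d9])
    simp only [norm_mul, Complex.norm_real, Complex.norm_I, Real.norm_eq_abs, mul_one]
    have : 0 ≤ |x| ^ 3 := by positivity
    nlinarith
  · calc _ ≤ ‖Complex.exp (x * Complex.I)‖ + ‖(1 : ℂ)‖ + ‖(x * Complex.I : ℂ)‖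
            + ‖(x ^ 2 / 2 : ℂ)‖ :=
          (norm_add_le _ _).trans
            (by gcongr; exact (norm_sub_le _ _).trans (by gcongr; exact norm_sub_le _ _))
      _ = 2 + |x| + |x| ^ 2 / 2 := by
          rw [Complex.norm_exp_ofReal_mul_I]
          simp
          norm_num
      _ ≤ 4 * |x| ^ 3 := by
          nlinarith [mul_pos (sub_pos.2 hx) (sub_pos.2 hx), pow_pos (zero_lt_one.trans hx) 2,
            mul_pos (sub_pos.2 hx) (pow_pos (zero_lt_one.trans hx) 2)]

/-- The left half-plane is convex and the derivative of `exp` has norm at most 1 there. -/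
lemma Complex.norm_exp_sub_exp_le {z w : ℂ} (hz : z.re ≤ 0) (hw : w.re ≤ 0) :
    ‖Complex.exp z - Complex.exp w‖ ≤ ‖z - w‖ := by
  have h := Convex.norm_image_sub_le_of_norm_deriv_le (f := Complex.exp) (C := 1)
    (s := {z : ℂ | z.re ≤ 0}) (x := w) (y := z)
    (fun x _ => Complex.differentiable_exp.differentiableAt) (fun x hx => ?_)
    (convex_halfSpace_re_le 0) hw hz
  · simpa using h
  · have hx : x.re ≤ 0 := hx
    simpa [Complex.norm_exp] using hx

/-- The minimum of `A` and `B` is at most any weighted geometric mean. This interpolation trades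
powers of `u` for a power `(1-a)^(-p)` that the mixing law can integrate. -/
lemma le_mul_rpow_mul_rpow_of_le {x K A B s : ℝ} (hK : 0 ≤ K) (hA : 0 < A) (hB : 0 < B)
    (hs0 : 0 ≤ s) (hs1 : s ≤ 1) (h1 : x ≤ K * A) (h2 : x ≤ K * B) :
    x ≤ K * (A ^ (1 - s) * B ^ s) := by
  rcases le_total A B with h | h
  · refine h1.trans ?_
    gcongr
    calc A = A ^ (1 - s) * A ^ s := by rw [← Real.rpow_add hA]; simp
      _ ≤ A ^ (1 - s) * B ^ s := by gcongr
  · refine h2.trans ?_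
    gcongr
    calc B = B ^ (1 - s) * B ^ s := by rw [← Real.rpow_add hB]; simp
      _ ≤ A ^ (1 - s) * B ^ s := by
        gcongr

section ExpIntegral

variable {Ω : Type*} [MeasurableSpace Ω] {Q : Measure Ω} [IsProbabilityMeasure Q]

lemma integrable_exp_mul_I {T : Ω → ℝ} (hT : AEMeasurable T Q) :
    Integrable (fun ω => Complex.exp (T ω * Complex.I)) Q := by
  refine Integrable.mono' (integrable_const (1 : ℝ)) ?_ ?_
  · exact (Complex.measurable_exp.comp_aemeasurable
      ((Complex.measurable_ofReal.comp_aemeasurable hT).mul_const _)).aestronglyMeasurable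
  · exact ae_of_all _ fun ω => by rw [Complex.norm_exp_ofReal_mul_I]

lemma norm_integral_exp_mul_I_sub_one_le {T : Ω → ℝ} (hT : MemLp T 2 Q)
    (h0 : ∫ ω, T ω ∂Q = 0) :
    ‖∫ ω, Complex.exp (T ω * Complex.I) ∂Q - 1‖ ≤ 3 * ∫ ω, T ω ^ 2 ∂Q := by
  have hi := hT.integrable one_le_two
  have e : ∫ ω, Complex.exp (T ω * Complex.I) ∂Q - 1
      = ∫ ω, (Complex.exp (T ω * Complex.I) - 1 - T ω * Complex.I) ∂Q := by
    have h1 := integrable_exp_mul_I (Q := Q) hi.aemeasurable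
    have h2 : Integrable (fun ω => Complex.exp (T ω * Complex.I) - 1) Q :=
      h1.sub (integrable_const 1)
    have h3 : Integrable (fun ω => (T ω : ℂ) * Complex.I) Q := hi.ofReal.mul_const _
    rw [integral_sub h2 h3,
      integral_sub h1 (integrable_const 1), integral_mul_const, integral_complex_ofReal, h0]
    simp
  rw [e, ← integral_const_mul]
  refine norm_integral_le_of_norm_le (hT.integrable_sq.const_mul 3) ?_
  exact ae_of_all _ fun ω => norm_exp_mul_I_sub_one_sub_le _

lemma norm_integral_exp_mul_I_sub_le {T T' : Ω → ℝ} (hT : AEMeasurable T Q)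
    (hT' : AEMeasurable T' Q) (hi : Integrable (fun ω => T ω - T' ω) Q) :
    ‖∫ ω, Complex.exp (T ω * Complex.I) ∂Q - ∫ ω, Complex.exp (T' ω * Complex.I) ∂Q‖
      ≤ ∫ ω, |T ω - T' ω| ∂Q := by
  rw [← integral_sub (integrable_exp_mul_I hT) (integrable_exp_mul_I hT')]
  refine norm_integral_le_of_norm_le hi.abs (ae_of_all _ fun ω => ?_)
  have h := Complex.norm_exp_sub_exp_le (z := T ω * Complex.I) (w := T' ω * Complex.I)
    (by simp) (by simp)
  refine h.trans_eq ?_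
  rw [← sub_mul, ← Complex.ofReal_sub, norm_mul, Complex.norm_I, mul_one, Complex.norm_real,
    Real.norm_eq_abs]

end ExpIntegral

/-! ### Gaussian approximation of the conditional characteristic function -/

namespace IsInar

variable {Ω : Type*} [MeasurableSpace Ω] {Q : Measure Ω} [IsProbabilityMeasure Q] {lam a : ℝ}
  {Z : InarIndex → Ω → ℕ}

/-- Telescope into `k` increments and apply Cauchy–Schwarz; each increment contributes `2 * lam`. -/
lemma integral_sub_init_sq_le (hZ : IsInar Q lam a Z) (hlam : 0 < lam)
    (ha : a ∈ Set.Ioo (0 : ℝ) 1) (k : ℕ) :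
    ∫ ω, ((inarProcess Z k ω : ℝ) - inarProcess Z 0 ω) ^ 2 ∂Q ≤ 2 * lam * k ^ 2 := by
  have hm := fun k => (hZ.moments hlam ha k).1
  have hd : ∀ j, Integrable (fun ω => ((inarProcess Z (j + 1) ω : ℝ) - inarProcess Z j ω) ^ 2) Q :=
    fun j => ((hm (j + 1)).sub (hm j)).integrable_sq
  calc ∫ ω, ((inarProcess Z k ω : ℝ) - inarProcess Z 0 ω) ^ 2 ∂Q
      ≤ ∫ ω, (k : ℝ) * ∑ j ∈ Finset.range k,
          ((inarProcess Z (j + 1) ω : ℝ) - inarProcess Z j ω) ^ 2 ∂Q := by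
        refine integral_mono ((hm k).sub (hm 0)).integrable_sq
          ((integrable_finsetSum _ fun j _ => hd j).const_mul _) fun ω => ?_
        have := sq_sum_le_card_mul_sum_sq (s := Finset.range k)
          (f := fun j => (inarProcess Z (j + 1) ω : ℝ) - inarProcess Z j ω)
        rw [Finset.sum_range_sub (fun j => (inarProcess Z j ω : ℝ)), Finset.card_range] at this
        exact this
    _ = 2 * lam * k ^ 2 := by
        rw [integral_const_mul, integral_finsetSum _ fun j _ => hd j]
        simp only [hZ.integral_succ_sub_sq hlam ha, Finset.sum_const, Finset.card_range,
          nsmul_eq_mul]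
        ring

/-- A bound for the second moment of `∑ c k * (X k - X 0)`. -/
noncomputable def incrementBound (lam : ℝ) (s : Finset ℕ) (c : ℕ → ℝ) : ℝ :=
  s.card * ∑ k ∈ s, c k ^ 2 * (2 * lam * k ^ 2)

lemma incrementBound_nonneg (hlam : 0 < lam) (s : Finset ℕ) (c : ℕ → ℝ) :
    0 ≤ incrementBound lam s c := by
  unfold incrementBound
  positivity

lemma memLp_sum_sub_init (hZ : IsInar Q lam a Z) (hlam : 0 < lam)
    (ha : a ∈ Set.Ioo (0 : ℝ) 1) (s : Finset ℕ) (c : ℕ → ℝ) :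
    MemLp (fun ω => ∑ k ∈ s, c k * ((inarProcess Z k ω : ℝ) - inarProcess Z 0 ω)) 2 Q :=
  memLp_finsetSum _ fun k _ =>
    (((hZ.moments hlam ha k).1.sub (hZ.moments hlam ha 0).1).const_mul (c k))

lemma integral_sum_sub_init_sq_le (hZ : IsInar Q lam a Z) (hlam : 0 < lam)
    (ha : a ∈ Set.Ioo (0 : ℝ) 1) (s : Finset ℕ) (c : ℕ → ℝ) :
    ∫ ω, (∑ k ∈ s, c k * ((inarProcess Z k ω : ℝ) - inarProcess Z 0 ω)) ^ 2 ∂Q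
      ≤ incrementBound lam s c := by
  have hm := fun k => (hZ.moments hlam ha k).1
  have hd : ∀ k, Integrable
      (fun ω => c k ^ 2 * ((inarProcess Z k ω : ℝ) - inarProcess Z 0 ω) ^ 2) Q :=
    fun k => ((hm k).sub (hm 0)).integrable_sq.const_mul _
  calc _ ≤ ∫ ω, (s.card : ℝ) * ∑ k ∈ s,
          c k ^ 2 * ((inarProcess Z k ω : ℝ) - inarProcess Z 0 ω) ^ 2 ∂Q := by
        refine integral_mono (hZ.memLp_sum_sub_init hlam ha s c).integrable_sq
          ((integrable_finsetSum _ fun j _ => hd j).const_mul _) fun ω => ?_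
        have := sq_sum_le_card_mul_sum_sq (s := s)
          (f := fun k => c k * ((inarProcess Z k ω : ℝ) - inarProcess Z 0 ω))
        simpa only [mul_pow] using this
    _ ≤ incrementBound lam s c := by
        rw [integral_const_mul, integral_finsetSum _ fun j _ => hd j, incrementBound]
        gcongr with k hk
        rw [integral_const_mul]
        gcongr
        exact hZ.integral_sub_init_sq_le hlam ha k

lemma integral_exp_init (hZ : IsInar Q lam a Z) (hlam : 0 < lam)
    (ha : a ∈ Set.Ioo (0 : ℝ) 1) (x : ℝ) :
    ∫ ω, Complex.exp ((x * ((inarProcess Z 0 ω : ℝ) - lam / (1 - a)) : ℝ) * Complex.I) ∂Q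
      = Complex.exp ((lam / (1 - a) : ℝ) *
          (Complex.exp (x * Complex.I) - 1 - x * Complex.I)) := by
  have h1a : 0 < 1 - a := by linarith [ha.2]
  set m := lam / (1 - a) with hm
  have hm0 : 0 ≤ m := by positivity
  have h := charFun_map_cast_poissonMeasure m.toNNReal x
  rw [← hZ.map_init hlam ha, Measure.map_map (by fun_prop) (hZ.measurable _), charFun_apply_real,
    integral_map (by have := hZ.measurable .init; fun_prop) (by fun_prop)] at h
  have e : ∀ ω, Complex.exp ((x * ((inarProcess Z 0 ω : ℝ) - m) : ℝ) * Complex.I)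
      = Complex.exp (x * ((((fun n : ℕ => (n : ℝ)) ∘ Z .init) ω : ℝ) : ℂ) * Complex.I)
        * Complex.exp (-(m * x * Complex.I)) := by
    intro ω
    rw [← Complex.exp_add]
    simp only [inarProcess, Function.comp_apply]
    push_cast
    ring_nf
  simp_rw [e]
  rw [integral_mul_const]
  refine (congrArg (· * Complex.exp (-(m * x * Complex.I))) h).trans ?_
  rw [← Complex.exp_add]
  rw [Real.coe_toNNReal _ hm0]
  ring_nf

/-- The constant in the Gaussian approximation of conditional characteristic functions. -/
noncomputable def gaussianErrorConst (lam : ℝ) (s : Finset ℕ) (c : ℕ → ℝ) : ℝ :=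
  3 + 7 * incrementBound lam s c + 9 * (∑ k ∈ s, c k) ^ 2 * lam + 4 * lam * |∑ k ∈ s, c k| ^ 3

/-- The exponent of the Poisson characteristic function and its quadratic part both have nonpositive
real part, so the difference is at most 2, and also at most `4 lam |C|³ u³/(1-a)` by third-order
Taylor expansion. Interpolating gives `(u³/(1-a))^p`. -/
lemma norm_integral_exp_init_sub_gaussian_le (hZ : IsInar Q lam a Z) (hlam : 0 < lam)
    (ha : a ∈ Set.Ioo (0 : ℝ) 1) (s : Finset ℕ) (c : ℕ → ℝ) {u p : ℝ} (hu : 0 < u)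
    (hp0 : 0 ≤ p) (hp1 : p ≤ 1) :
    ‖∫ ω, Complex.exp ((u * (∑ k ∈ s, c k) * ((inarProcess Z 0 ω : ℝ) - lam / (1 - a)) : ℝ)
        * Complex.I) ∂Q
      - (Real.exp (-(lam * (∑ k ∈ s, c k) ^ 2 / 2 * u ^ 2 / (1 - a))) : ℝ)‖
      ≤ gaussianErrorConst lam s c * (u ^ (3 * p) * (1 - a) ^ (-p)) := by
  have h1a : 0 < 1 - a := by linarith [ha.2]
  have hD := incrementBound_nonneg hlam s c
  rw [hZ.integral_exp_init hlam ha]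
  set C := ∑ k ∈ s, c k with hC
  set m := lam / (1 - a) with hm
  have hm0 : 0 ≤ m := by positivity
  set z : ℂ := (m : ℝ) * (Complex.exp ((u * C : ℝ) * Complex.I) - 1 - (u * C : ℝ) * Complex.I)
  set y : ℝ := -(lam * C ^ 2 / 2 * u ^ 2 / (1 - a)) with hy
  have hzre : z.re ≤ 0 := by
    have : z.re = m * (Real.cos (u * C) - 1) := by
      simp only [z, Complex.re_ofReal_mul, Complex.sub_re, Complex.exp_ofReal_mul_I_re,
        Complex.one_re, Complex.I_re, mul_zero, sub_zero]
    rw [this]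
    exact mul_nonpos_of_nonneg_of_nonpos hm0 (by linarith [Real.cos_le_one (u * C)])
  have hy0 : y ≤ 0 := by
    rw [hy, Left.neg_nonpos_iff]
    positivity
  rw [Complex.ofReal_exp]
  have b1 : ‖Complex.exp z - Complex.exp y‖ ≤ 2 := by
    refine (norm_sub_le _ _).trans ?_
    rw [Complex.norm_exp, Complex.norm_exp]
    have e1 := Real.exp_le_one_iff.2 hzre
    have e2 := Real.exp_le_one_iff.2 (show (y : ℂ).re ≤ 0 by simpa using hy0)
    linarith
  have b2 : ‖Complex.exp z - Complex.exp y‖ ≤ 4 * lam * |C| ^ 3 * (u ^ 3 / (1 - a)) := by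
    refine (Complex.norm_exp_sub_exp_le hzre (by simpa using hy0)).trans ?_
    have : z - y = (m : ℝ) * (Complex.exp ((u * C : ℝ) * Complex.I) - 1
        - (u * C : ℝ) * Complex.I + ((u * C : ℝ) : ℂ) ^ 2 / 2) := by
      have hy' : y = -(m * (u * C) ^ 2 / 2) := by rw [hy, hm]; ring
      simp only [z]
      rw [hy']
      push_cast
      ring
    rw [this, norm_mul, Complex.norm_real, Real.norm_of_nonneg hm0]
    refine (mul_le_mul_of_nonneg_left (norm_exp_mul_I_sub_taylor_two_le _) hm0).trans_eq ?_
    rw [abs_mul, abs_of_pos hu, hm]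
    ring
  have hK : 0 ≤ gaussianErrorConst lam s c := by
    unfold gaussianErrorConst
    positivity
  have hu3 : 0 < u ^ 3 / (1 - a) := by positivity
  refine (le_mul_rpow_mul_rpow_of_le hK one_pos hu3 hp0 hp1 (b1.trans ?_) (b2.trans ?_)).trans_eq ?_
  · unfold gaussianErrorConst
    have : 0 ≤ 9 * C ^ 2 * lam + 4 * lam * |C| ^ 3 := by positivity
    linarith
  · gcongr
    unfold gaussianErrorConst
    have : 0 ≤ 9 * C ^ 2 * lam := by positivity
    linarith
  · rw [Real.one_rpow, one_mul, Real.div_rpow (by positivity) h1a.le, Real.rpow_neg h1a.le,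
      ← Real.rpow_natCast, ← Real.rpow_mul hu.le]
    push_cast
    rfl

/-- Two bounds are interpolated. Since the remainder `R` is bounded in `L¹`, the difference is
`O(u)`; since both sums are centred with variance `O(1/(1-a))`, each characteristic function is
within `O(u²/(1-a))` of 1. The weighted mean is `u^{1-p} (u²/(1-a))^p`. -/
lemma norm_integral_exp_sub_integral_exp_init_le (hZ : IsInar Q lam a Z) (hlam : 0 < lam)
    (ha : a ∈ Set.Ioo (0 : ℝ) 1) (s : Finset ℕ) (c : ℕ → ℝ) {u p : ℝ} (hu : 0 < u)
    (hp0 : 0 ≤ p) (hp1 : p ≤ 1) :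
    ‖∫ ω, Complex.exp ((u * ∑ k ∈ s, c k * ((inarProcess Z k ω : ℝ) - lam / (1 - a)) : ℝ)
        * Complex.I) ∂Q
      - ∫ ω, Complex.exp ((u * (∑ k ∈ s, c k) * ((inarProcess Z 0 ω : ℝ) - lam / (1 - a)) : ℝ)
        * Complex.I) ∂Q‖
      ≤ gaussianErrorConst lam s c * (u ^ (1 + p) * (1 - a) ^ (-p)) := by
  have h1a : 0 < 1 - a := by linarith [ha.2]
  have hD := incrementBound_nonneg hlam s c
  have hmom := hZ.moments hlam ha
  have hRm := hZ.memLp_sum_sub_init hlam ha s c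
  have hR2 := hZ.integral_sum_sub_init_sq_le hlam ha s c
  set C := ∑ k ∈ s, c k with hC
  set m := lam / (1 - a) with hm
  set R : Ω → ℝ := fun ω => ∑ k ∈ s, c k * ((inarProcess Z k ω : ℝ) - inarProcess Z 0 ω) with hR
  set T : Ω → ℝ := fun ω => ∑ k ∈ s, c k * ((inarProcess Z k ω : ℝ) - m) with hT
  set T' : Ω → ℝ := fun ω => C * ((inarProcess Z 0 ω : ℝ) - m) with hT'
  have hTR : ∀ ω, T ω = T' ω + R ω := by
    intro ω
    simp only [hT, hT', hR, hC]
    rw [Finset.sum_mul, ← Finset.sum_add_distrib]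
    exact Finset.sum_congr rfl fun k _ => by ring
  have hcm : ∀ k, MemLp (fun ω => (inarProcess Z k ω : ℝ) - m) 2 Q :=
    fun k => (hmom k).1.sub (memLp_const m)
  have hc0 : ∀ k, ∫ ω, ((inarProcess Z k ω : ℝ) - m) ∂Q = 0 := by
    intro k
    rw [integral_sub ((hmom k).1.integrable one_le_two) (integrable_const m), (hmom k).2.1]
    simp
  have hTm : MemLp T 2 Q := memLp_finsetSum _ fun k _ => (hcm k).const_mul (c k)
  have hT'm : MemLp T' 2 Q := (hcm 0).const_mul C
  have hT0 : ∫ ω, T ω ∂Q = 0 := by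
    simp only [hT]
    rw [integral_finsetSum _ fun k _ => ((hcm k).integrable one_le_two).const_mul (c k)]
    simp [integral_const_mul, hc0]
  have hT'0 : ∫ ω, T' ω ∂Q = 0 := by
    simp only [hT']
    rw [integral_const_mul, hc0, mul_zero]
  have hT'2 : ∫ ω, T' ω ^ 2 ∂Q = C ^ 2 * m := by
    simp only [hT', mul_pow]
    rw [integral_const_mul, (hmom 0).2.2]
  have hT2 : ∫ ω, T ω ^ 2 ∂Q ≤ 2 * (C ^ 2 * m) + 2 * incrementBound lam s c := by
    calc ∫ ω, T ω ^ 2 ∂Q ≤ ∫ ω, (2 * T' ω ^ 2 + 2 * R ω ^ 2) ∂Q := by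
          refine integral_mono hTm.integrable_sq
            ((hT'm.integrable_sq.const_mul 2).add (hRm.integrable_sq.const_mul 2)) fun ω => ?_
          simp only [hTR ω]
          nlinarith [sq_nonneg (T' ω - R ω)]
      _ ≤ _ := by
          rw [integral_add (hT'm.integrable_sq.const_mul 2) (hRm.integrable_sq.const_mul 2),
            integral_const_mul, integral_const_mul, hT'2]
          linarith
  have hRabs : ∫ ω, |R ω| ∂Q ≤ 1 + incrementBound lam s c := by
    calc ∫ ω, |R ω| ∂Q ≤ ∫ ω, (1 + R ω ^ 2) ∂Q := by
          refine integral_mono (hRm.integrable one_le_two).abs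
            ((integrable_const 1).add hRm.integrable_sq) fun ω => ?_
          simp only
          nlinarith [sq_abs (R ω), sq_nonneg (|R ω| - 1)]
      _ ≤ _ := by
          rw [integral_add (integrable_const 1) hRm.integrable_sq]
          simp only [integral_const, probReal_univ, one_smul]
          linarith
  have hass : ∀ ω, u * C * ((inarProcess Z 0 ω : ℝ) - m) = u * T' ω := fun ω => by
    simp only [hT']
    ring
  simp_rw [hass]
  have hK : 0 ≤ gaussianErrorConst lam s c := by
    unfold gaussianErrorConst
    positivity
  have hu2 : 0 < u ^ 2 / (1 - a) := by positivity
  have huT : MemLp (fun ω => u * T ω) 2 Q := hTm.const_mul u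
  have huT' : MemLp (fun ω => u * T' ω) 2 Q := hT'm.const_mul u
  have b1 := norm_integral_exp_mul_I_sub_le (Q := Q) (T := fun ω => u * T ω)
    (T' := fun ω => u * T' ω) (huT.integrable one_le_two).aemeasurable
    (huT'.integrable one_le_two).aemeasurable
    ((huT.integrable one_le_two).sub (huT'.integrable one_le_two))
  have e1 : ∫ ω, |u * T ω - u * T' ω| ∂Q = u * ∫ ω, |R ω| ∂Q := by
    rw [← integral_const_mul]
    refine integral_congr_ae (ae_of_all _ fun ω => ?_)
    simp only
    rw [← mul_sub, hTR ω, add_sub_cancel_left, abs_mul, abs_of_pos hu]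
  rw [e1] at b1
  have b2 := norm_integral_exp_mul_I_sub_one_le huT (by rw [integral_const_mul, hT0, mul_zero])
  have b3 := norm_integral_exp_mul_I_sub_one_le huT' (by rw [integral_const_mul, hT'0, mul_zero])
  simp only [mul_pow] at b2 b3
  rw [integral_const_mul] at b2 b3
  rw [hT'2] at b3
  refine (le_mul_rpow_mul_rpow_of_le hK hu hu2 hp0 hp1 (b1.trans ?_) ?_).trans_eq ?_
  · rw [mul_comm]
    gcongr
    refine hRabs.trans ?_
    unfold gaussianErrorConst
    have : 0 ≤ 9 * C ^ 2 * lam + 4 * lam * |C| ^ 3 := by positivity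
    linarith
  · have tri := norm_sub_le_norm_sub_add_norm_sub
      (∫ ω, Complex.exp ((u * T ω : ℝ) * Complex.I) ∂Q) 1
      (∫ ω, Complex.exp ((u * T' ω : ℝ) * Complex.I) ∂Q)
    rw [norm_sub_rev (1 : ℂ)] at tri
    refine tri.trans ((add_le_add b2 b3).trans ?_)
    have hD' : incrementBound lam s c ≤ incrementBound lam s c / (1 - a) := by
      rw [le_div_iff₀ h1a]
      nlinarith [ha.1]
    calc 3 * (u ^ 2 * ∫ ω, T ω ^ 2 ∂Q) + 3 * (u ^ 2 * (C ^ 2 * m))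
        ≤ 3 * (u ^ 2 * (2 * (C ^ 2 * m) + 2 * (incrementBound lam s c / (1 - a))))
          + 3 * (u ^ 2 * (C ^ 2 * m)) := by
          gcongr
          linarith
      _ = (9 * C ^ 2 * lam + 6 * incrementBound lam s c) * (u ^ 2 / (1 - a)) := by
          rw [hm]
          field_simp
          ring
      _ ≤ _ := by
          gcongr
          unfold gaussianErrorConst
          have : 0 ≤ 4 * lam * |C| ^ 3 := by positivity
          linarith
  · rw [Real.div_rpow (by positivity) h1a.le, Real.rpow_neg h1a.le, ← Real.rpow_natCast u 2,
      ← Real.rpow_mul hu.le, mul_div_assoc', ← Real.rpow_add hu]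
    push_cast
    rw [show 1 - p + 2 * p = 1 + p by ring]
    rfl

lemma norm_integral_exp_sub_gaussian_le (hZ : IsInar Q lam a Z) (hlam : 0 < lam)
    (ha : a ∈ Set.Ioo (0 : ℝ) 1) (s : Finset ℕ) (c : ℕ → ℝ) {u p : ℝ} (hu : 0 < u)
    (hp0 : 0 ≤ p) (hp1 : p ≤ 1) :
    ‖∫ ω, Complex.exp ((u * ∑ k ∈ s, c k * ((inarProcess Z k ω : ℝ) - lam / (1 - a)) : ℝ)
        * Complex.I) ∂Q
      - (Real.exp (-(lam * (∑ k ∈ s, c k) ^ 2 / 2 * u ^ 2 / (1 - a))) : ℝ)‖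
      ≤ gaussianErrorConst lam s c * (u ^ (1 + p) + u ^ (3 * p)) * (1 - a) ^ (-p) := by
  refine (norm_sub_le_norm_sub_add_norm_sub _ _ _).trans ((add_le_add
    (hZ.norm_integral_exp_sub_integral_exp_init_le hlam ha s c hu hp0 hp1)
    (hZ.norm_integral_exp_init_sub_gaussian_le hlam ha s c hu hp0 hp1)).trans_eq ?_)
  ring

end IsInar

/-! ### Disintegration with respect to the random parameter -/

instance : Countable InarIndex := by
  let f : InarIndex → Option (ℕ ⊕ ℕ × ℕ) := fun i => match i with
    | .init => none
    | .innov k => some (.inl k)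
    | .offspring k i => some (.inr (k, i))
  refine Function.Injective.countable (f := f) fun i j h => ?_
  cases i <;> cases j <;> simp_all [f]

lemma inarProcess_comp {Ω Ω' : Type*} (Z : InarIndex → Ω → ℕ) (f : Ω' → Ω) (k : ℕ) (ω : Ω') :
    inarProcess (fun i ω => Z i (f ω)) k ω = inarProcess Z k (f ω) := by
  induction k with
  | zero => rfl
  | succ k ih => simp only [inarProcess, ih]

/-- Presents the path as a functional on the coordinate space `InarIndex → ℕ`, where the conditional
laws live. -/
lemma inarProcess_eq_eval {Ω : Type*} (Z : InarIndex → Ω → ℕ) (k : ℕ) (ω : Ω) :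
    inarProcess Z k ω
      = inarProcess (fun (i : InarIndex) (z : InarIndex → ℕ) => z i) k (fun i => Z i ω) :=
  inarProcess_comp (fun (i : InarIndex) (z : InarIndex → ℕ) => z i) (fun ω i => Z i ω) k ω

/-- The one-coordinate events `z i = l` form a π-system generating the σ-algebra of that coordinate.
Finitely supported `x` are enough for any finite `s`; for countable `ι` the hypothesis is then a
countable family of identities. -/
lemma iIndepFun_eval_of_singleton {ι : Type*} {Q : Measure (ι → ℕ)} [IsProbabilityMeasure Q]
    (h : ∀ (s : Finset ι) (x : ι →₀ ℕ), Q.real (⋂ i ∈ s, {z | z i = x i})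
      = ∏ i ∈ s, Q.real {z | z i = x i}) :
    iIndepFun (fun (i : ι) (z : ι → ℕ) => z i) Q := by
  classical
  rw [iIndepFun_iff_iIndep]
  refine iIndepSets.iIndep (π := fun i => Set.range fun l : ℕ => {z : ι → ℕ | z i = l})
    (fun i => (measurable_pi_apply i).comap_le) (fun i => ?_) (fun i => ?_) ?_
  · rintro _ ⟨l, rfl⟩ _ ⟨l', rfl⟩ ⟨z, hz, hz'⟩
    have : l = l' := Eq.trans (Eq.symm hz) hz'
    subst this
    exact ⟨l, by simp⟩
  · refine le_antisymm ?_ ?_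
    · rintro _ ⟨t, -, rfl⟩
      have : (fun z : ι → ℕ => z i) ⁻¹' t = ⋃ l ∈ t, {z : ι → ℕ | z i = l} := by
        ext z
        simp
      rw [this]
      exact MeasurableSet.biUnion t.to_countable fun l _ =>
        MeasurableSpace.measurableSet_generateFrom ⟨l, rfl⟩
    · refine MeasurableSpace.generateFrom_le ?_
      rintro _ ⟨l, rfl⟩
      exact ⟨{l}, measurableSet_singleton l, by ext z; simp⟩
  · rw [iIndepSets_iff]
    intro s f hf
    have hx : ∃ x : ι →₀ ℕ, ∀ i ∈ s, f i = {z : ι → ℕ | z i = x i} := by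
      choose! l hl using hf
      refine ⟨Finsupp.onFinset s (fun i => if i ∈ s then l i else 0) (by simp_all), fun i hi => ?_⟩
      rw [← hl i hi]
      simp [hi]
    obtain ⟨x, hx⟩ := hx
    have e1 : (⋂ i ∈ s, f i) = ⋂ i ∈ s, {z : ι → ℕ | z i = x i} :=
      Set.iInter₂_congr fun i hi => hx i hi
    have e2 : ∏ i ∈ s, Q (f i) = ∏ i ∈ s, Q {z : ι → ℕ | z i = x i} :=
      Finset.prod_congr rfl fun i hi => by rw [hx i hi]
    rw [e1, e2, ← ENNReal.toReal_eq_toReal_iff' (measure_ne_top _ _)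
      (ENNReal.prod_ne_top fun _ _ => measure_ne_top _ _), ENNReal.toReal_prod]
    exact h s x

namespace IsRandomizedInar

variable {Ω : Type*} [MeasurableSpace Ω] {P : Measure Ω} [IsProbabilityMeasure P] {lam : ℝ}
  {A : Ω → ℝ} {Z : InarIndex → Ω → ℕ}

lemma measurable_pi {Ω : Type*} [MeasurableSpace Ω] {P : Measure Ω} {lam : ℝ}
    {A : Ω → ℝ} {Z : InarIndex → Ω → ℕ} (hZ : IsRandomizedInar P lam A Z) : Measurable fun ω i => Z i ω :=
  measurable_pi_iff.2 hZ.measurable_prim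

/-- The conditional law of the primitive variables given the thinning parameter. -/
noncomputable abbrev kernel (P : Measure Ω) [IsProbabilityMeasure P] (A : Ω → ℝ)
    (Z : InarIndex → Ω → ℕ) : Kernel ℝ (InarIndex → ℕ) :=
  condDistrib (fun ω i => Z i ω) A P

lemma ae_kernel_real_eq (hZ : IsRandomizedInar P lam A Z) {s : Set (InarIndex → ℕ)}
    (hs : MeasurableSet s) {f : ℝ → ℝ} (hf : Measurable f)
    (h : P⟦(fun ω i => Z i ω) ⁻¹' s | sigmaOf A⟧ =ᵐ[P] fun ω => f (A ω)) :
    ∀ᵐ a ∂(P.map A), (kernel P A Z a).real s = f a := by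
  rw [ae_map_iff hZ.measurable_param.aemeasurable]
  · exact (condDistrib_ae_eq_condExp hZ.measurable_param hZ.measurable_pi hs).trans h
  · exact measurableSet_eq_fun (Kernel.measurable_coe _ hs).ennreal_toReal hf

lemma ae_kernel_iInter (hZ : IsRandomizedInar P lam A Z) (s : Finset InarIndex)
    (x : InarIndex → ℕ) :
    ∀ᵐ a ∂(P.map A), (kernel P A Z a).real (⋂ i ∈ s, {z | z i = x i})
      = ∏ i ∈ s, (kernel P A Z a).real {z | z i = x i} := by
  have hm : ∀ i, MeasurableSet {z : InarIndex → ℕ | z i = x i} := fun i =>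
    measurableSet_eq_fun (measurable_pi_apply i) measurable_const
  refine hZ.ae_kernel_real_eq (Finset.measurableSet_biInter s fun i _ => hm i)
    (f := fun a => ∏ i ∈ s, (kernel P A Z a).real {z | z i = x i})
    (Finset.measurable_fun_prod _ fun i _ => (Kernel.measurable_coe _ (hm i)).ennreal_toReal) ?_
  have h1 := hZ.condIndep s (fun i => {x i})
  have e : ((fun ω i => Z i ω) ⁻¹' ⋂ i ∈ s, {z : InarIndex → ℕ | z i = x i})
      = ⋂ i ∈ s, Z i ⁻¹' {x i} := by
    ext ω
    simp
  rw [e]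
  refine h1.trans ?_
  have h2 : ∀ᵐ ω ∂P, ∀ i ∈ s, (P⟦Z i ⁻¹' {x i} | sigmaOf A⟧) ω
      = (kernel P A Z (A ω)).real {z | z i = x i} := by
    refine (ae_ball_iff s.countable_toSet).2 fun i _ => ?_
    exact (condDistrib_ae_eq_condExp hZ.measurable_param hZ.measurable_pi (hm i)).symm
  filter_upwards [h2] with ω hω
  rw [Finset.prod_apply]
  exact Finset.prod_congr rfl hω

/-- Given the thinning parameter, the process is an INAR(1) process with that parameter. -/
lemma ae_isInar (hZ : IsRandomizedInar P lam A Z) :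
    ∀ᵐ a ∂(P.map A), IsInar (kernel P A Z a) lam a fun i z => z i := by
  have hm : ∀ (i : InarIndex) (l : ℕ),
      MeasurableSet ((fun z : InarIndex → ℕ => z i) ⁻¹' {l}) := fun i l =>
    measurable_pi_apply i (measurableSet_singleton l)
  -- Finite index sets and finitely supported value vectors are countable in number, so a single
  -- null set of parameters serves them all.
  have h1 : ∀ᵐ a ∂(P.map A), ∀ (s : Finset InarIndex) (x : InarIndex →₀ ℕ),
      (kernel P A Z a).real (⋂ i ∈ s, {z | z i = x i})
        = ∏ i ∈ s, (kernel P A Z a).real {z | z i = x i} :=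
    ae_all_iff.2 fun s => ae_all_iff.2 fun x => hZ.ae_kernel_iInter s x
  have h2 := ae_all_iff.2 fun k => ae_all_iff.2 fun i =>
    hZ.ae_kernel_real_eq (hm (.offspring k i) 1) measurable_id (hZ.offspring_one k i)
  have h3 := ae_all_iff.2 fun k => ae_all_iff.2 fun i =>
    hZ.ae_kernel_real_eq (hm (.offspring k i) 0) (f := fun a => 1 - a) (by fun_prop)
      (hZ.offspring_zero k i)
  have h4 := ae_all_iff.2 fun k => ae_all_iff.2 fun l =>
    hZ.ae_kernel_real_eq (hm (.innov k) l)
      (f := fun _ => lam ^ l / (l.factorial : ℝ) * Real.exp (-lam)) (by fun_prop)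
      (hZ.innov_poisson k l)
  have h5 := ae_all_iff.2 fun l => hZ.ae_kernel_real_eq (hm .init l)
      (f := fun a => lam ^ l / ((l.factorial : ℝ) * (1 - a) ^ l)
        * Real.exp (-((1 - a)⁻¹ * lam))) (by fun_prop) (hZ.init_poisson l)
  filter_upwards [h1, h2, h3, h4, h5] with a h1 h2 h3 h4 h5
  refine ⟨fun i => measurable_pi_apply i, iIndepFun_eval_of_singleton h1, h2, h3, h4, fun l => ?_⟩
  rw [h5 l, div_pow, div_eq_inv_mul lam (1 - a)]
  congr 1
  rw [div_div, mul_comm]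

lemma ae_map_mem {Ω : Type*} [MeasurableSpace Ω] {P : Measure Ω} {lam : ℝ}
    {A : Ω → ℝ} {Z : InarIndex → Ω → ℕ} (hZ : IsRandomizedInar P lam A Z) :
    ∀ᵐ a ∂(P.map A), a ∈ Set.Ioo (0 : ℝ) 1 :=
  (ae_map_iff hZ.measurable_param.aemeasurable measurableSet_Ioo).2 hZ.param_mem

lemma lintegral_eq (hZ : IsRandomizedInar P lam A Z) {f : ℝ × (InarIndex → ℕ) → ℝ≥0∞}
    (hf : Measurable f) :
    ∫⁻ ω, f (A ω, fun i => Z i ω) ∂P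
      = ∫⁻ a, ∫⁻ z, f (a, z) ∂(kernel P A Z a) ∂(P.map A) := by
  rw [← Measure.lintegral_compProd hf, compProd_map_condDistrib hZ.measurable_pi.aemeasurable,
    lintegral_map hf (hZ.measurable_param.prodMk hZ.measurable_pi)]

lemma integral_eq (hZ : IsRandomizedInar P lam A Z) {f : ℝ × (InarIndex → ℕ) → ℂ}
    (hf : Measurable f) (hb : ∀ p, ‖f p‖ ≤ 1) :
    ∫ ω, f (A ω, fun i => Z i ω) ∂P
      = ∫ a, ∫ z, f (a, z) ∂(kernel P A Z a) ∂(P.map A) := by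
  have := Measure.isProbabilityMeasure_map (μ := P) hZ.measurable_param.aemeasurable
  rw [← Measure.integral_compProd, compProd_map_condDistrib hZ.measurable_pi.aemeasurable,
    integral_map (hZ.measurable_param.prodMk hZ.measurable_pi).aemeasurable
      hf.aestronglyMeasurable]
  exact Integrable.mono' (integrable_const (1 : ℝ)) hf.aestronglyMeasurable (ae_of_all _ hb)

lemma measurable_inarProcess_eval (k : ℕ) :
    Measurable (inarProcess (fun (i : InarIndex) (z : InarIndex → ℕ) => z i) k) :=
  measurable_inarProcess fun i _ => measurable_pi_apply i

/-- By uniqueness of the conditional expectation it suffices to compare integrals over the sets `A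
⁻¹' B`; after disintegration the inner integral is the stationary mean. Everything is in `ℝ≥0∞`,
because `lam / (1 - A)` need not be integrable. -/
lemma condMean_ae_eq (hZ : IsRandomizedInar P lam A Z) (hlam : 0 < lam) (k : ℕ) :
    condMean P A (inarProcess Z k) =ᵐ[P] fun ω => lam / (1 - A ω) := by
  have hX := measurable_inarProcess_eval k
  have key : (fun ω => ENNReal.ofReal (lam / (1 - A ω)))
      =ᵐ[P] condLExp (sigmaOf A) P (fun ω => (inarProcess Z k ω : ℝ≥0∞)) := by
    refine ae_eq_condLExp hZ.measurable_param.comap_le P _ ?_ ?_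
    · exact (by fun_prop : Measurable fun a : ℝ => ENNReal.ofReal (lam / (1 - a))).comp
        (comap_measurable A)
    · rintro _ ⟨B, hB, rfl⟩
      have hAB := hZ.measurable_param hB
      rw [← lintegral_indicator hAB, ← lintegral_indicator hAB]
      have e1 := hZ.lintegral_eq (f := fun p => B.indicator (fun _ =>
        (inarProcess (fun (i : InarIndex) (z : InarIndex → ℕ) => z i) k p.2 : ℝ≥0∞)) p.1) (by
          have : Measurable fun p : ℝ × (InarIndex → ℕ) =>
            (inarProcess (fun (i : InarIndex) (z : InarIndex → ℕ) => z i) k p.2 : ℝ≥0∞) :=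
            (measurable_of_countable _).comp (hX.comp measurable_snd)
          exact this.indicator (measurable_fst hB))
      have e2 := hZ.lintegral_eq
        (f := fun p => B.indicator (fun a => ENNReal.ofReal (lam / (1 - a))) p.1)
        ((Measurable.indicator (by fun_prop) hB).comp measurable_fst)
      have e3 : ∫⁻ ω, (A ⁻¹' B).indicator (fun ω => (inarProcess Z k ω : ℝ≥0∞)) ω ∂P
          = ∫⁻ ω, B.indicator (fun _ => (inarProcess
            (fun (i : InarIndex) (z : InarIndex → ℕ) => z i) k (fun i => Z i ω) : ℝ≥0∞)) (A ω) ∂P :=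
        lintegral_congr fun ω => by
          simp only [Set.indicator, inarProcess_eq_eval Z k ω]
          rfl
      rw [e3]
      refine (e2.trans ?_).trans e1.symm
      refine lintegral_congr_ae ?_
      filter_upwards [hZ.ae_isInar, hZ.ae_map_mem] with a hI ha
      by_cases haB : a ∈ B
      · simp only [Set.indicator_of_mem haB, lintegral_const, measure_univ, mul_one]
        obtain ⟨m1, m2, -⟩ := hI.moments hlam ha k
        rw [← m2, ofReal_integral_eq_lintegral_ofReal (m1.integrable one_le_two)
          (ae_of_all _ fun z => Nat.cast_nonneg _)]
        simp
      · simp [Set.indicator_of_notMem haB]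
  filter_upwards [key, hZ.param_mem] with ω hω ha
  have h1a : 0 < 1 - A ω := by linarith [ha.2]
  rw [condMean, ← hω, ENNReal.toReal_ofReal (by positivity)]

end IsRandomizedInar

/-! ### Gaussian mixtures, products over copies, and the limit in `N` -/

/-- Replace the factors one at a time; all others stay in the unit disc, so the errors only add. -/
lemma norm_prod_sub_pow_card_le {ι : Type*} (s : Finset ι) (f : ι → ℂ) (b : ℂ) {e : ℝ}
    (hf : ∀ i ∈ s, ‖f i‖ ≤ 1) (hb : ‖b‖ ≤ 1) (he : ∀ i ∈ s, ‖f i - b‖ ≤ e) :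
    ‖∏ i ∈ s, f i - b ^ s.card‖ ≤ s.card * e := by
  classical
  induction s using Finset.induction_on with
  | empty => simp
  | insert i s hi ih =>
    rw [Finset.prod_insert hi, Finset.card_insert_of_notMem hi, pow_succ]
    have e1 : f i * ∏ j ∈ s, f j - b ^ s.card * b
        = f i * (∏ j ∈ s, f j - b ^ s.card) + (f i - b) * b ^ s.card := by ring
    rw [e1]
    have h1 := ih (fun j hj => hf j (Finset.mem_insert_of_mem hj))
      (fun j hj => he j (Finset.mem_insert_of_mem hj))
    have h2 := hf i (Finset.mem_insert_self i s)
    have h3 := he i (Finset.mem_insert_self i s)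
    have h4 : ‖b ^ s.card‖ ≤ 1 := by
      rw [norm_pow]
      exact pow_le_one₀ (norm_nonneg _) hb
    calc _ ≤ ‖f i‖ * ‖∏ j ∈ s, f j - b ^ s.card‖ + ‖f i - b‖ * ‖b ^ s.card‖ := by
          refine (norm_add_le _ _).trans ?_
          rw [norm_mul, norm_mul]
      _ ≤ 1 * (s.card * e) + e * 1 := by
          have : 0 ≤ e := (norm_nonneg _).trans h3
          gcongr
      _ = ((s.card + 1 : ℕ) : ℝ) * e := by
          push_cast
          ring

/-- A linear functional of one path, centred by the conditional mean. -/
noncomputable def centredSum (lam : ℝ) (s : Finset ℕ) (c : ℕ → ℝ) (p : ℝ × (ℕ → ℕ)) : ℝ :=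
  ∑ k ∈ s, c k * ((p.2 k : ℝ) - lam / (1 - p.1))

lemma measurable_centredSum (lam : ℝ) (s : Finset ℕ) (c : ℕ → ℝ) :
    Measurable (centredSum lam s c) := by
  refine Finset.measurable_fun_sum _ fun k _ => Measurable.const_mul (Measurable.sub ?_ ?_) _
  · exact (measurable_of_countable (fun n : ℕ => (n : ℝ))).comp
      ((measurable_pi_apply k).comp measurable_snd)
  · fun_prop

namespace IsRandomizedInar

variable {Ω : Type*} [MeasurableSpace Ω] {P : Measure Ω} [IsProbabilityMeasure P] {lam : ℝ}
  {A : Ω → ℝ} {Z : InarIndex → Ω → ℕ}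

lemma measurable_pair {Ω : Type*} [MeasurableSpace Ω] {P : Measure Ω} {lam : ℝ}
    {A : Ω → ℝ} {Z : InarIndex → Ω → ℕ} (hZ : IsRandomizedInar P lam A Z) :
    Measurable fun ω => (A ω, fun k => inarProcess Z k ω) :=
  hZ.measurable_param.prodMk (measurable_pi_iff.2 fun _ =>
    measurable_inarProcess fun i _ => hZ.measurable_prim i)

/-- Gaussian mixture approximation of the characteristic function of one centred path. -/
lemma norm_integral_exp_sub_mixture_le (hZ : IsRandomizedInar P lam A Z) (hlam : 0 < lam)
    (s : Finset ℕ) (c : ℕ → ℝ) {u p : ℝ} (hu : 0 < u) (hp0 : 0 ≤ p) (hp1 : p ≤ 1)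
    (hint : Integrable (fun a => (1 - a) ^ (-p)) (P.map A)) :
    ‖∫ ω, Complex.exp ((u * centredSum lam s c (A ω, fun k => inarProcess Z k ω) : ℝ)
        * Complex.I) ∂P
      - (∫ a, Real.exp (-(lam * (∑ k ∈ s, c k) ^ 2 / 2 * u ^ 2 / (1 - a))) ∂(P.map A) : ℝ)‖
      ≤ IsInar.gaussianErrorConst lam s c * (u ^ (1 + p) + u ^ (3 * p))
        * ∫ a, (1 - a) ^ (-p) ∂(P.map A) := by
  have := Measure.isProbabilityMeasure_map (μ := P) hZ.measurable_param.aemeasurable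
  set F : ℝ × (InarIndex → ℕ) → ℂ := fun q => Complex.exp ((u * centredSum lam s c
    (q.1, fun k => inarProcess (fun (i : InarIndex) (z : InarIndex → ℕ) => z i) k q.2) : ℝ)
      * Complex.I) with hF
  have hFm : Measurable F := by
    have : Measurable fun q : ℝ × (InarIndex → ℕ) => (q.1,
        fun k => inarProcess (fun (i : InarIndex) (z : InarIndex → ℕ) => z i) k q.2) :=
      measurable_fst.prodMk (measurable_pi_iff.2 fun k =>
        (measurable_inarProcess_eval k).comp measurable_snd)
    have := (measurable_centredSum lam s c).comp this
    exact Complex.measurable_exp.comp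
      ((Complex.measurable_ofReal.comp (this.const_mul u)).mul_const _)
  have hFb : ∀ q, ‖F q‖ ≤ 1 := fun q => by rw [hF, Complex.norm_exp_ofReal_mul_I]
  have e1 : ∫ ω, Complex.exp ((u * centredSum lam s c (A ω, fun k => inarProcess Z k ω) : ℝ)
        * Complex.I) ∂P = ∫ a, ∫ z, F (a, z) ∂(kernel P A Z a) ∂(P.map A) := by
    rw [← hZ.integral_eq hFm hFb]
    simp_rw [hF, inarProcess_eq_eval Z]
  have hFi : Integrable (fun a => ∫ z, F (a, z) ∂(kernel P A Z a)) (P.map A) := by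
    refine Integrable.mono' (integrable_const (1 : ℝ))
      hFm.stronglyMeasurable.integral_condDistrib.aestronglyMeasurable (ae_of_all _ fun a => ?_)
    exact (norm_integral_le_of_norm_le (integrable_const (1 : ℝ))
      (ae_of_all _ fun z => hFb (a, z))).trans (by simp)
  have hGi : Integrable (fun a => Real.exp (-(lam * (∑ k ∈ s, c k) ^ 2 / 2 * u ^ 2 / (1 - a))))
      (P.map A) := by
    refine Integrable.mono' (integrable_const (1 : ℝ)) (by fun_prop :
      Measurable fun a : ℝ => Real.exp (-(lam * (∑ k ∈ s, c k) ^ 2 / 2 * u ^ 2 / (1 - a)))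
      ).aestronglyMeasurable ?_
    filter_upwards [hZ.ae_map_mem] with a ha
    have : 0 < 1 - a := by linarith [ha.2]
    rw [Real.norm_of_nonneg (Real.exp_pos _).le]
    refine Real.exp_le_one_iff.2 ?_
    rw [Left.neg_nonpos_iff]
    positivity
  have hGi' : Integrable (fun a => ((Real.exp (-(lam * (∑ k ∈ s, c k) ^ 2 / 2 * u ^ 2 / (1 - a)))
      : ℝ) : ℂ)) (P.map A) := hGi.ofReal
  rw [e1, ← integral_complex_ofReal, ← integral_sub hFi hGi', ← integral_const_mul]
  refine norm_integral_le_of_norm_le (hint.const_mul _) ?_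
  filter_upwards [hZ.ae_isInar, hZ.ae_map_mem] with a hI ha
  exact hI.norm_integral_exp_sub_gaussian_le hlam ha s c hu hp0 hp1

end IsRandomizedInar

lemma tendsto_natCast_rpow_neg_nhdsGT {r : ℝ} (hr : 0 < r) :
    Tendsto (fun N : ℕ => (N : ℝ) ^ (-r)) atTop (𝓝[>] 0) := by
  refine tendsto_nhdsWithin_iff.2 ⟨(tendsto_rpow_neg_atTop hr).comp tendsto_natCast_atTop_atTop, ?_⟩
  filter_upwards [eventually_gt_atTop 0] with N hN
  have : (0 : ℝ) < N := by exact_mod_cast hN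
  exact Real.rpow_pos_of_pos this _

/-- With `u = N^{-1/(2(1+β))}` the normalization `u^{-2(1+β)}` is exactly `N`, so the Abelian
asymptotics read `N (1 - ρ) → t`, where `ρ` is the mixture, and hence `ρ^N → e^{-t}`. -/
lemma tendsto_pow_integral_mixingMeasure {ψ : ℝ → ℝ} {β ψ₁ κ : ℝ}
    (hβ : β ∈ Set.Ioo (-1 : ℝ) 0)
    (hψ_meas : AEMeasurable ψ (volume.restrict (Set.Ioo (0 : ℝ) 1)))
    (hψ_nonneg : ∀ x ∈ Set.Ioo (0 : ℝ) 1, 0 ≤ ψ x)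
    (hψ_lim : Tendsto ψ (𝓝[<] 1) (𝓝 ψ₁)) [IsProbabilityMeasure (mixingMeasure ψ β)]
    (hκ : 0 ≤ κ) :
    Tendsto (fun N : ℕ => (∫ a, Real.exp (-(κ * ((N : ℝ) ^ (-(1 / (2 * (1 + β))))) ^ 2 / (1 - a)))
        ∂(mixingMeasure ψ β)) ^ N)
      atTop (𝓝 (Real.exp (-(ψ₁ * (κ ^ (1 + β) * (Real.Gamma (-β) / (1 + β))))))) := by
  have hb : 0 < 1 + β := by linarith [hβ.1]
  have hu := tendsto_natCast_rpow_neg_nhdsGT (r := 1 / (2 * (1 + β))) (by positivity)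
  have h := (tendsto_rpow_mul_integral_mixingMeasure hβ hψ_meas hψ_nonneg hψ_lim hκ).comp hu
  have h' := Real.tendsto_one_add_pow_exp_of_tendsto
    (g := fun N : ℕ => -∫ a, (1 - Real.exp (-(κ * ((N : ℝ) ^ (-(1 / (2 * (1 + β))))) ^ 2 / (1 - a))))
        ∂(mixingMeasure ψ β)) (t := -(ψ₁ * (κ ^ (1 + β) * (Real.Gamma (-β) / (1 + β))))) ?_
  · refine h'.congr fun N => ?_
    congr 1
    rw [integral_sub (integrable_const 1)]
    · simp
    · refine Integrable.mono' (integrable_const (1 : ℝ)) (by fun_prop : Measurable fun a : ℝ =>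
        Real.exp (-(κ * ((N : ℝ) ^ (-(1 / (2 * (1 + β))))) ^ 2 / (1 - a)))).aestronglyMeasurable ?_
      filter_upwards [ae_mixingMeasure_mem] with a ha
      have : 0 < 1 - a := by linarith [ha.2]
      rw [Real.norm_of_nonneg (Real.exp_pos _).le]
      refine Real.exp_le_one_iff.2 ?_
      rw [Left.neg_nonpos_iff]
      positivity
  · refine h.neg.congr' ?_
    filter_upwards [eventually_gt_atTop 0] with N hN
    have hN' : (0 : ℝ) < N := by exact_mod_cast hN
    simp only [Function.comp_apply]
    rw [← Real.rpow_mul hN'.le, show -(1 / (2 * (1 + β))) * -(2 * (1 + β)) = 1 by field_simp,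
      Real.rpow_one]
    ring

/-- The lower bounds on `p` are `2β + 1` and `2(1+β)/3`. Both lie below `1 + β`, the first because
`β < 0` and the second because `β > -1`; the second is positive. -/
lemma exists_error_exponent {β : ℝ} (hβ : β ∈ Set.Ioo (-1 : ℝ) 0) :
    ∃ p, 0 ≤ p ∧ p ≤ 1 ∧ p < 1 + β ∧ 2 * (1 + β) < 1 + p ∧ 2 * (1 + β) < 3 * p := by
  obtain ⟨h1, h2⟩ := hβ
  have : max (2 * β + 1) (2 / 3 * (1 + β)) < 1 + β := max_lt (by linarith) (by linarith)
  obtain ⟨p, hp, hp'⟩ := exists_between this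
  obtain ⟨q1, q2⟩ := max_lt_iff.1 hp
  exact ⟨p, by linarith, by linarith, hp', by linarith, by linarith⟩

lemma tendsto_natCast_mul_rpow_zero {r q : ℝ} (hr : 0 < r) (hq : r < q) :
    Tendsto (fun N : ℕ => (N : ℝ) * ((N : ℝ) ^ (-(1 / r))) ^ q) atTop (𝓝 0) := by
  have h : 0 < q / r - 1 := by
    rw [sub_pos, one_lt_div hr]
    exact hq
  refine ((tendsto_rpow_neg_atTop h).comp tendsto_natCast_atTop_atTop).congr' ?_
  filter_upwards [eventually_gt_atTop 0] with N hN
  have hN' : (0 : ℝ) < N := by exact_mod_cast hN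
  simp only [Function.comp_apply]
  rw [← Real.rpow_mul hN'.le]
  nth_rewrite 2 [← Real.rpow_one (N : ℝ)]
  rw [← Real.rpow_add hN']
  congr 1
  field_simp
  ring

/-- Characteristic functions of normalized sums of linear functionals of independent randomized
INAR(1) paths converge to a symmetric stable characteristic function. -/
lemma tendsto_integral_exp_sum_centredSum {Ω : Type*} [MeasurableSpace Ω] {P : Measure Ω}
    [IsProbabilityMeasure P] {lam : ℝ} (hlam : 0 < lam) {β : ℝ} (hβ : β ∈ Set.Ioo (-1 : ℝ) 0)
    {ψ : ℝ → ℝ} {ψ₁ : ℝ} (hψ_meas : AEMeasurable ψ (volume.restrict (Set.Ioo (0 : ℝ) 1)))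
    (hψ_nonneg : ∀ x ∈ Set.Ioo (0 : ℝ) 1, 0 ≤ ψ x)
    (hψ_lim : Tendsto ψ (𝓝[<] 1) (𝓝 ψ₁))
    {A : ℕ → Ω → ℝ} {Z : ℕ → InarIndex → Ω → ℕ}
    (hZ : ∀ j, IsRandomizedInar P lam (A j) (Z j))
    (hA : ∀ j, P.map (A j) = mixingMeasure ψ β)
    (hindep : iIndepFun (fun (j : ℕ) (ω : Ω) => (A j ω, fun k : ℕ => inarProcess (Z j) k ω)) P)
    (s : Finset ℕ) (c : ℕ → ℝ) :
    Tendsto (fun N : ℕ => ∫ ω, Complex.exp (((N : ℝ) ^ (-(1 / (2 * (1 + β)))) *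
        ∑ j ∈ Finset.range N, centredSum lam s c (A j ω, fun k => inarProcess (Z j) k ω) : ℝ)
          * Complex.I) ∂P) atTop
      (𝓝 ((Real.exp (-(ψ₁ * (lam / 2) ^ (1 + β) * (Real.Gamma (-β) / (1 + β))
            * |∑ k ∈ s, c k| ^ (2 * (1 + β)))) : ℝ) : ℂ)) := by
  have hb : 0 < 1 + β := by linarith [hβ.1]
  have hprob : IsProbabilityMeasure (mixingMeasure ψ β) := by
    rw [← hA 0]
    exact Measure.isProbabilityMeasure_map (hZ 0).measurable_param.aemeasurable
  obtain ⟨p, hp0, hp1, hpβ, hq1, hq2⟩ := exists_error_exponent hβ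
  have hint := integrable_mixingMeasure_one_sub_rpow hψ_meas hψ_nonneg hψ_lim hp0 hpβ
  set C := ∑ k ∈ s, c k with hC
  set κ := lam * C ^ 2 / 2 with hκdef
  have hκ : 0 ≤ κ := by positivity
  have hlim := tendsto_pow_integral_mixingMeasure hβ hψ_meas hψ_nonneg hψ_lim hκ
  -- Since `κ = (lam/2) |C|²`, raising to the power `1 + β` produces the stable index `2(1+β)`.
  have hκpow : ψ₁ * (κ ^ (1 + β) * (Real.Gamma (-β) / (1 + β)))
      = ψ₁ * (lam / 2) ^ (1 + β) * (Real.Gamma (-β) / (1 + β)) * |C| ^ (2 * (1 + β)) := by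
    rw [hκdef, show lam * C ^ 2 / 2 = lam / 2 * |C| ^ 2 by rw [sq_abs]; ring,
      Real.mul_rpow (by positivity) (by positivity), ← Real.rpow_natCast |C| 2,
      ← Real.rpow_mul (abs_nonneg C)]
    push_cast
    ring
  rw [hκpow] at hlim
  set T : ℕ → Ω → ℝ := fun j ω => centredSum lam s c (A j ω, fun k => inarProcess (Z j) k ω) with hT
  have hTm : ∀ j, Measurable (T j) := fun j =>
    (measurable_centredSum lam s c).comp (hZ j).measurable_pair
  have hTi : iIndepFun T P := hindep.comp (fun _ => centredSum lam s c)
    fun _ => measurable_centredSum lam s c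
  have hprod : ∀ (N : ℕ) (u : ℝ), ∫ ω, Complex.exp ((u * ∑ j ∈ Finset.range N, T j ω : ℝ)
      * Complex.I) ∂P
      = ∏ j ∈ Finset.range N, ∫ ω, Complex.exp ((u * T j ω : ℝ) * Complex.I) ∂P := by
    intro N u
    have h := congrFun ((hTi.restrict (Finset.range N)).charFun_map_fun_finsetSum_eq_prod
      (fun j _ => (hTm j).aemeasurable)) u
    rw [Finset.prod_apply, charFun_apply_real, integral_map (by fun_prop) (by fun_prop)] at h
    simp only [← Complex.ofReal_mul] at h
    rw [h]
    refine Finset.prod_congr rfl fun j _ => ?_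
    rw [charFun_apply_real, integral_map (by fun_prop) (by fun_prop)]
    simp only [← Complex.ofReal_mul]
  set ρ : ℝ → ℝ := fun u => ∫ a, Real.exp (-(κ * u ^ 2 / (1 - a))) ∂(mixingMeasure ψ β) with hρ
  have hρ1 : ∀ u, ‖(ρ u : ℂ)‖ ≤ 1 := by
    intro u
    rw [Complex.norm_real]
    refine (norm_integral_le_of_norm_le (integrable_const (1 : ℝ)) ?_).trans (by simp)
    filter_upwards [ae_mixingMeasure_mem] with a ha
    have : 0 < 1 - a := by linarith [ha.2]
    rw [Real.norm_of_nonneg (Real.exp_pos _).le]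
    refine Real.exp_le_one_iff.2 ?_
    rw [Left.neg_nonpos_iff]
    positivity
  set M := IsInar.gaussianErrorConst lam s c * ∫ a, (1 - a) ^ (-p) ∂(mixingMeasure ψ β) with hM
  have hbound : ∀ (N : ℕ) (u : ℝ), 0 < u →
      ‖∏ j ∈ Finset.range N, ∫ ω, Complex.exp ((u * T j ω : ℝ) * Complex.I) ∂P - (ρ u : ℂ) ^ N‖
        ≤ M * (N * u ^ (1 + p) + N * u ^ (3 * p)) := by
    intro N u hu
    have h := norm_prod_sub_pow_card_le (Finset.range N)
      (fun j => ∫ ω, Complex.exp ((u * T j ω : ℝ) * Complex.I) ∂P) (ρ u : ℂ)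
      (e := M * (u ^ (1 + p) + u ^ (3 * p))) (fun j _ => ?_) (hρ1 u) (fun j _ => ?_)
    · rw [Finset.card_range] at h
      refine h.trans_eq ?_
      ring
    · refine (norm_integral_le_of_norm_le (integrable_const (1 : ℝ))
        (ae_of_all _ fun ω => ?_)).trans (by simp)
      rw [Complex.norm_exp_ofReal_mul_I]
    · have hj := (hZ j).norm_integral_exp_sub_mixture_le hlam s c hu hp0 hp1
        (by rw [hA j]; exact hint)
      rw [hA j] at hj
      refine hj.trans_eq ?_
      rw [hM]
      ring
  have hu := tendsto_natCast_rpow_neg_nhdsGT (r := 1 / (2 * (1 + β))) (by positivity)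
  have herr : Tendsto (fun N : ℕ => M * ((N : ℝ) * ((N : ℝ) ^ (-(1 / (2 * (1 + β))))) ^ (1 + p)
      + (N : ℝ) * ((N : ℝ) ^ (-(1 / (2 * (1 + β))))) ^ (3 * p))) atTop (𝓝 0) := by
    have h1 := tendsto_natCast_mul_rpow_zero (by positivity : 0 < 2 * (1 + β)) hq1
    have h2 := tendsto_natCast_mul_rpow_zero (by positivity : 0 < 2 * (1 + β)) hq2
    simpa using (h1.add h2).const_mul M
  have hlimC := (Complex.continuous_ofReal.tendsto _).comp hlim
  refine Tendsto.congr (fun N => (hprod N _).symm) ?_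
  -- The product of true characteristic functions and `ρ(u)^N` differ by at most `M (N u^{1+p} + N
  -- u^{3p})`, which tends to 0.
  refine (tendsto_iff_of_dist ?_).2 hlimC
  refine squeeze_zero' (Eventually.of_forall fun _ => dist_nonneg) ?_ herr
  filter_upwards [hu self_mem_nhdsWithin] with N hN
  rw [dist_eq_norm]
  have := hbound N _ hN
  simpa only [Function.comp_apply, Complex.ofReal_pow] using this

/-! ### Lévy continuity, Cramér–Wold and stability -/

/-- A pointwise limit of characteristic functions which is continuous at `0` is a characteristic
function. -/
lemma exists_probabilityMeasure_charFun_eq {μ : ℕ → ProbabilityMeasure ℝ} {f : ℝ → ℂ}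
    (hf : ContinuousAt f 0)
    (h : ∀ t, Tendsto (fun n => charFun (μ n : Measure ℝ) t) atTop (𝓝 (f t))) :
    ∃ ν : ProbabilityMeasure ℝ, ∀ t, charFun (ν : Measure ℝ) t = f t := by
  -- Continuity of the limit at 0 gives tightness, Prokhorov gives a cluster point, and along an
  -- ultrafilter converging to it the characteristic functions must have the limit `f`.
  have htight : IsTightMeasureSet (Set.range fun n => (μ n : Measure ℝ)) :=
    isTightMeasureSet_of_tendsto_charFun hf h
  have hcompact : IsCompact (closure (Set.range μ)) := by
    refine isCompact_closure_of_isTightMeasureSet ?_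
    convert htight using 1
    ext ρ
    simp
  obtain ⟨ν, -, hν⟩ := hcompact.exists_mapClusterPt (f := atTop) (u := μ)
    (tendsto_principal.2 (Eventually.of_forall fun n => subset_closure (Set.mem_range_self n)))
  refine ⟨ν, fun t => ?_⟩
  obtain ⟨U, hU, hUν⟩ := mapClusterPt_iff_ultrafilter.1 hν
  rw [ProbabilityMeasure.tendsto_iff_forall_integral_rclike_tendsto ℂ] at hUν
  have h1 := hUν (BoundedContinuousFunction.innerProbChar t)
  simp_rw [← charFun_eq_integral_innerProbChar] at h1
  exact tendsto_nhds_unique h1 ((h t).mono_left hU)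

lemma charFun_map_toLp {Ω ι : Type*} [Fintype ι] [MeasurableSpace Ω] {Q : Measure Ω}
    {Y : Ω → ι → ℝ} (hY : AEMeasurable Y Q) (θ : EuclideanSpace ℝ ι) :
    charFun (Q.map fun ω => (WithLp.toLp 2 (Y ω) : EuclideanSpace ℝ ι)) θ
      = ∫ ω, Complex.exp ((∑ i, θ i * Y ω i : ℝ) * Complex.I) ∂Q := by
  rw [charFun_apply, integral_map (φ := fun ω => (WithLp.toLp 2 (Y ω) : EuclideanSpace ℝ ι))
    (by fun_prop) (by fun_prop)]
  simp [PiLp.inner_apply]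

/-- **Cramér–Wold**: convergence of the characteristic functions of all linear combinations of the
coordinates implies convergence in distribution. -/
lemma tendstoInDistribution_pi_of_tendsto_integral_exp {Ω Ω' ι : Type*} [Fintype ι]
    [MeasurableSpace Ω]
    [MeasurableSpace Ω'] {P : Measure Ω} [IsProbabilityMeasure P] {P' : Measure Ω'}
    [IsProbabilityMeasure P'] {X : ℕ → Ω → ι → ℝ} {W : Ω' → ι → ℝ}
    (hX : ∀ n, AEMeasurable (X n) P) (hW : AEMeasurable W P')
    (h : ∀ θ : ι → ℝ, Tendsto
      (fun n => ∫ ω, Complex.exp ((∑ i, θ i * X n ω i : ℝ) * Complex.I) ∂P) atTop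
      (𝓝 (∫ ω, Complex.exp ((∑ i, θ i * W ω i : ℝ) * Complex.I) ∂P'))) :
    TendstoInDistribution X atTop W (fun _ => P) P' := by
  -- Characteristic functions need an inner product, so convergence is proved in `EuclideanSpace`
  -- and carried back by the continuous identification.
  have hlp : Measurable (WithLp.toLp 2 : (ι → ℝ) → EuclideanSpace ℝ ι) := by fun_prop
  have hE : TendstoInDistribution
      (fun n ω => (WithLp.toLp 2 (X n ω) : EuclideanSpace ℝ ι)) atTop
      (fun ω => (WithLp.toLp 2 (W ω) : EuclideanSpace ℝ ι)) (fun _ => P) P' := by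
    refine ⟨fun n => hlp.comp_aemeasurable (hX n), hlp.comp_aemeasurable hW, ?_⟩
    refine ProbabilityMeasure.tendsto_of_tendsto_charFun fun θ => ?_
    have := h θ
    rw [← charFun_map_toLp hW] at this
    exact this.congr fun n => (charFun_map_toLp (hX n) θ).symm
  exact hE.continuous_comp (g := fun x : EuclideanSpace ℝ ι => WithLp.ofLp x) (by fun_prop)

/-- Characteristic functions determine laws: evenness in `θ` gives symmetry, and `b^a |θ|^a + c^a
|θ|^a = |(b^a + c^a)^{1/a} θ|^a` gives stability. -/
lemma isSymmetricStable_of_charFun {a K : ℝ} (ha : a ∈ Set.Ioc (0 : ℝ) 2) (hK : 0 < K)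
    {ν : Measure ℝ} [IsProbabilityMeasure ν]
    (h : ∀ θ : ℝ, charFun ν θ = ((Real.exp (-(K * |θ| ^ a)) : ℝ) : ℂ)) :
    IsSymmetricStable a ν := by
  have hm : ∀ r : ℝ, IsProbabilityMeasure (ν.map fun x => r * x) := fun r =>
    Measure.isProbabilityMeasure_map (by fun_prop)
  refine ⟨ha, inferInstance, ?_, ?_, ?_⟩
  · rintro rfl
    have h1 := h 1
    rw [charFun_dirac] at h1
    simp only [inner_zero_left, Complex.ofReal_zero, zero_mul, Complex.exp_zero, abs_one,
      Real.one_rpow, mul_one] at h1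
    have h2 : (1 : ℝ) = Real.exp (-K) := by exact_mod_cast h1
    have := Real.exp_lt_exp.2 (show -K < 0 by linarith)
    rw [Real.exp_zero] at this
    linarith
  · have : IsProbabilityMeasure (ν.map fun x => -x) :=
      Measure.isProbabilityMeasure_map (by fun_prop)
    refine Measure.ext_of_charFun (funext fun θ => ?_)
    have e := charFun_map_mul (μ := ν) (-1) θ
    simp only [neg_mul, one_mul] at e
    rw [e, h, h, abs_neg]
  · intro b c hb hc
    have := hm b
    have := hm c
    have := hm ((b ^ a + c ^ a) ^ (1 / a))
    refine Measure.ext_of_charFun (funext fun θ => ?_)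
    rw [charFun_conv, charFun_map_mul, charFun_map_mul, charFun_map_mul, h, h, h,
      ← Complex.ofReal_mul, ← Real.exp_add]
    have hbc : 0 ≤ b ^ a + c ^ a := by positivity
    congr 3
    rw [abs_mul, abs_mul, abs_mul, abs_of_pos hb, abs_of_pos hc,
      abs_of_nonneg (Real.rpow_nonneg hbc _), Real.mul_rpow hb.le (abs_nonneg _),
      Real.mul_rpow hc.le (abs_nonneg _), Real.mul_rpow (Real.rpow_nonneg hbc _) (abs_nonneg _),
      ← Real.rpow_mul hbc, one_div_mul_cancel ha.1.ne', Real.rpow_one]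
    ring

/-! ### The aggregated process and the iterated limit -/

lemma measurable_condMean {Ω : Type*} [MeasurableSpace Ω] (P : Measure Ω) (A : Ω → ℝ)
    (Y : Ω → ℕ) : Measurable (condMean P A Y) :=
  (measurable_condLExp' _ _ _).ennreal_toReal

/-- Puts sums up to different times on one common window, so that they combine into a single weight
sequence. -/
lemma sum_Icc_eq_sum_ite {M L : ℕ} (h : L ≤ M) (f : ℕ → ℝ) :
    ∑ k ∈ Finset.Icc 1 L, f k = ∑ k ∈ Finset.Icc 1 M, if k ≤ L then f k else 0 := by
  rw [← Finset.sum_filter]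
  refine Finset.sum_congr ?_ fun _ _ => rfl
  ext k
  simp only [Finset.mem_Icc, Finset.mem_filter]
  omega

/-- Linear combinations over several times of the aggregated process are sums of linear functionals
of the individual paths. -/
lemma sum_mul_aggregated_eq {Ω ι : Type*} [Fintype ι] [MeasurableSpace Ω] {P : Measure Ω}
    {lam : ℝ} {A : ℕ → Ω → ℝ} {X : ℕ → ℕ → Ω → ℕ} {ω : Ω}
    (hω : ∀ j k, condMean P (A j) (X j k) ω = lam / (1 - A j ω))
    (n N : ℕ) (t : ι → ℝ≥0) (θ : ι → ℝ) (r : ℝ) {M : ℕ} (hM : ∀ i, ⌊(n : ℝ≥0) * t i⌋₊ ≤ M) :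
    ∑ i, θ i * ((n : ℝ)⁻¹ * r * aggregated P A X N n (t i) ω)
      = r * ∑ j ∈ Finset.range N, centredSum lam (Finset.Icc 1 M)
        (fun k => ∑ i, if k ≤ ⌊(n : ℝ≥0) * t i⌋₊ then θ i * (n : ℝ)⁻¹ else 0)
        (A j ω, fun k => X j k ω) := by
  simp only [aggregated, centredSum, hω]
  simp_rw [fun i j => sum_Icc_eq_sum_ite (hM i) (fun k => ((X j k ω : ℝ) - lam / (1 - A j ω))),
    Finset.mul_sum, Finset.sum_mul]
  rw [Finset.sum_comm]
  simp_rw [Finset.mul_sum]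
  refine Finset.sum_congr rfl fun j _ => ?_
  rw [Finset.sum_comm]
  refine Finset.sum_congr rfl fun k _ => Finset.sum_congr rfl fun i _ => ?_
  split_ifs
  · ring
  · ring

/-- This total is the constant `C` through which alone the limit sees the weights; being linear in
`θ`, it forces a limit process that is one random variable times a deterministic function of time.
-/
lemma sum_step_weights_eq {ι : Type*} [Fintype ι] (n : ℕ) (t : ι → ℝ≥0) (θ : ι → ℝ) {M : ℕ}
    (hM : ∀ i, ⌊(n : ℝ≥0) * t i⌋₊ ≤ M) :
    ∑ k ∈ Finset.Icc 1 M, ∑ i, (if k ≤ ⌊(n : ℝ≥0) * t i⌋₊ then θ i * (n : ℝ)⁻¹ else 0)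
      = ∑ i, θ i * (⌊(n : ℝ≥0) * t i⌋₊ / n : ℝ) := by
  rw [Finset.sum_comm]
  refine Finset.sum_congr rfl fun i _ => ?_
  rw [← sum_Icc_eq_sum_ite (hM i) (fun _ => θ i * (n : ℝ)⁻¹)]
  simp
  ring

theorem mainTheorem2 {Ω : Type*} [MeasurableSpace Ω] (P : Measure Ω) [IsProbabilityMeasure P]
    (lam : ℝ) (hlam : 0 < lam)
    (β : ℝ) (hβ : β ∈ Set.Ioo (-1 : ℝ) 0)
    -- the mixing density `ψ(x) (1 - x) ^ β` on `(0, 1)`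
    (ψ : ℝ → ℝ) (ψ₁ : ℝ) (hψ₁ : 0 < ψ₁)
    (hψ_meas : AEMeasurable ψ (volume.restrict (Set.Ioo (0 : ℝ) 1)))
    (hψ_nonneg : ∀ x ∈ Set.Ioo (0 : ℝ) 1, 0 ≤ ψ x)
    (hψ_lim : Tendsto ψ (𝓝[<] 1) (𝓝 ψ₁))
    -- independent copies of the randomized INAR(1) process with their thinning parameters
    (A : ℕ → Ω → ℝ) (Z : ℕ → InarIndex → Ω → ℕ)
    (hZ : ∀ j, IsRandomizedInar P lam (A j) (Z j))
    (hA : ∀ j, P.map (A j) = (volume.restrict (Set.Ioo (0 : ℝ) 1)).withDensity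
      (fun x => ENNReal.ofReal (ψ x * (1 - x) ^ β)))
    (hindep : iIndepFun (fun (j : ℕ) (ω : Ω) => (A j ω, fun k : ℕ => inarProcess (Z j) k ω)) P) :
    ∃ (Ω' : Type) (_ : MeasurableSpace Ω') (P' : Measure Ω') (_ : IsProbabilityMeasure P')
      (V : Ω' → ℝ) (Y : ℕ → ℝ≥0 → Ω' → ℝ),
      Measurable V ∧
      IsSymmetricStable (2 * (1 + β)) (P'.map V) ∧
      (∀ θ : ℝ, charFun (P'.map V) θ
        = ((Real.exp (-(ψ₁ * (lam / 2) ^ (1 + β) * (Real.Gamma (-β) / (1 + β))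
            * |θ| ^ (2 * (1 + β)))) : ℝ) : ℂ)) ∧
      -- first `N → ∞` for each fixed `n ≥ 1`, with limit process `Y n`
      (∀ n : ℕ, 1 ≤ n →
        FddTendsto
          (fun (N : ℕ) (t : ℝ≥0) (ω : Ω) =>
            (n : ℝ)⁻¹ * (N : ℝ) ^ (-(1 / (2 * (1 + β))))
              * aggregated P A (fun j => inarProcess (Z j)) N n t ω) P
          (Y n) P') ∧
      -- then `n → ∞`
      FddTendsto Y P' (fun (t : ℝ≥0) (ω : Ω') => V ω * (t : ℝ)) P' := by
  have hb : 0 < 1 + β := by linarith [hβ.1]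
  have hΓ : 0 < Real.Gamma (-β) := Real.Gamma_pos_of_pos (by linarith [hβ.2])
  set K := ψ₁ * (lam / 2) ^ (1 + β) * (Real.Gamma (-β) / (1 + β)) with hK
  have hK0 : 0 < K := by positivity
  have hlim := tendsto_integral_exp_sum_centredSum hlam hβ hψ_meas hψ_nonneg hψ_lim hZ hA hindep
  rw [← hK] at hlim
  -- The law of `V` is obtained as the limit of the normalized sums of the centred initial values:
  -- window `{0}` with weight 1, for which testing at `θ` amounts to `C = θ`.
  obtain ⟨ν, hν⟩ : ∃ ν : ProbabilityMeasure ℝ, ∀ θ : ℝ, charFun (ν : Measure ℝ) θ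
      = ((Real.exp (-(K * |θ| ^ (2 * (1 + β)))) : ℝ) : ℂ) := by
    set S : ℕ → Ω → ℝ := fun N ω => (N : ℝ) ^ (-(1 / (2 * (1 + β)))) *
      ∑ j ∈ Finset.range N, centredSum lam {0} (fun _ => 1)
        (A j ω, fun k => inarProcess (Z j) k ω) with hS
    have hSm : ∀ N, Measurable (S N) := fun N => Measurable.const_mul
      (Finset.measurable_fun_sum _ fun j _ =>
        (measurable_centredSum lam {0} fun _ => 1).comp (hZ j).measurable_pair) _
    refine exists_probabilityMeasure_charFun_eq (μ := fun N => ⟨P.map (S N),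
      Measure.isProbabilityMeasure_map (hSm N).aemeasurable⟩) ?_ fun θ => ?_
    · refine ContinuousAt.comp (g := fun x : ℝ => (x : ℂ))
        Complex.continuous_ofReal.continuousAt ?_
      refine Real.continuous_exp.continuousAt.comp (ContinuousAt.neg ?_)
      refine continuousAt_const.mul ?_
      exact (continuous_abs.continuousAt).rpow_const (Or.inr (by positivity))
    · have h := hlim {0} (fun _ => θ)
      simp only [Finset.sum_singleton] at h
      refine h.congr fun N => ?_
      simp only [ProbabilityMeasure.coe_mk]
      rw [charFun_apply_real, integral_map (hSm N).aemeasurable (by fun_prop)]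
      refine integral_congr_ae (ae_of_all _ fun ω => ?_)
      simp only [hS, centredSum, Finset.sum_singleton, one_mul, ← Finset.mul_sum]
      rw [← Complex.ofReal_mul]
      congr 3
      ring
  -- The canonical space: `V` is the identity under `ν`, and `Y n t = V ⌊nt⌋/n`.
  refine ⟨ℝ, inferInstance, (ν : Measure ℝ), inferInstance, id,
    fun n t x => x * (⌊(n : ℝ≥0) * t⌋₊ / n : ℝ), measurable_id, ?_, ?_, ?_, ?_⟩
  · rw [Measure.map_id]
    exact isSymmetricStable_of_charFun ⟨by positivity, by linarith [hβ.2]⟩ hK0 hν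
  · rw [Measure.map_id]
    exact hν
  · intro n _ m t
    refine tendstoInDistribution_pi_of_tendsto_integral_exp (fun N => ?_) ?_ fun θ => ?_
    · refine (measurable_pi_iff.2 fun i => Measurable.const_mul ?_ _).aemeasurable
      refine Finset.measurable_fun_sum _ fun j _ => Finset.measurable_fun_sum _ fun k _ =>
        Measurable.sub ?_ (measurable_condMean _ _ _)
      exact (measurable_of_countable (fun n : ℕ => (n : ℝ))).comp
        (measurable_inarProcess fun i _ => (hZ j).measurable_prim i)
    · exact (measurable_pi_iff.2 fun i => by fun_prop).aemeasurable
    · set M := Finset.univ.sup fun i => ⌊(n : ℝ≥0) * t i⌋₊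
      have hM : ∀ i, ⌊(n : ℝ≥0) * t i⌋₊ ≤ M := fun i =>
        Finset.le_sup (f := fun i => ⌊(n : ℝ≥0) * t i⌋₊) (Finset.mem_univ i)
      have h := hlim (Finset.Icc 1 M)
        (fun k => ∑ i, if k ≤ ⌊(n : ℝ≥0) * t i⌋₊ then θ i * (n : ℝ)⁻¹ else 0)
      rw [sum_step_weights_eq n t θ hM, ← hν, charFun_apply_real] at h
      have hmean : ∀ᵐ ω ∂P, ∀ j k,
          condMean P (A j) (inarProcess (Z j) k) ω = lam / (1 - A j ω) :=
        ae_all_iff.2 fun j => ae_all_iff.2 fun k => (hZ j).condMean_ae_eq hlam k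
      have hl : ∫ x, Complex.exp ((∑ i, θ i * (x * (⌊(n : ℝ≥0) * t i⌋₊ / n : ℝ)) : ℝ)
            * Complex.I) ∂(ν : Measure ℝ)
          = ∫ x, Complex.exp (((∑ i, θ i * (⌊(n : ℝ≥0) * t i⌋₊ / n : ℝ) : ℝ) : ℂ) * x
            * Complex.I) ∂(ν : Measure ℝ) := by
        refine integral_congr_ae (ae_of_all _ fun x => ?_)
        simp only
        rw [← Complex.ofReal_mul, Finset.sum_mul]
        congr 3
        exact Finset.sum_congr rfl fun i _ => by ring
      rw [hl]
      refine h.congr fun N => integral_congr_ae ?_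
      filter_upwards [hmean] with ω hω
      rw [sum_mul_aggregated_eq (X := fun j => inarProcess (Z j)) hω n N t θ _ hM]
  · intro m t
    -- All `Y n` are built from the same `V`, so the second limit holds pointwise, from `⌊nt⌋/n →
    -- t`.
    refine tendstoInDistribution_of_ae_tendsto
      (fun n => (measurable_pi_iff.2 fun i => by fun_prop).aemeasurable)
      (measurable_pi_iff.2 fun i => by fun_prop).aemeasurable (ae_of_all _ fun x => ?_)
    refine tendsto_pi_nhds.2 fun i => Tendsto.const_mul x ?_
    have h := (tendsto_nat_floor_mul_div_atTop (R := ℝ) (t i).coe_nonneg).comp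
      tendsto_natCast_atTop_atTop
    refine h.congr fun n => ?_
    simp only [Function.comp_apply]
    congr 2
    rw [mul_comm]
    exact_mod_cast Nonneg.nat_floor_coe ((n : ℝ≥0) * t i)
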